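/- Let $0<\kappa<1$ and let $F={}_2F_1$ be the Gauss hypergeometric function. Put $$f(T)=\int_0^T F\left(\tfrac14,\tfrac34;\tfrac12;\kappa^2\sin^2 t\right)\,dt$$ for complex $T$ near $0$; let $\phi$ be the analytic inverse of $f$ near $0$ with $\phi(0)=0$, and let $\psi$ be the analytic function near $0$ with $\psi(0)=0$ and $\sin\psi=\kappa\sin\phi$. Then the function $\cos\psi$, defined near $0$, extends to a unique meromorphic function $\mathrm{dn}_2$ on $\mathbb{C}$. There are real numbers $K_\kappa>0$ and $K_\kappa'>0$ such that $2K_\kappa$ and $2iK_\kappa'$ are fundamental periods of $\mathrm{dn}_2$, that is, the periods of $\mathrm{dn}_2$ are exactly the numbers $2mK_\kappa+2inK_\kappa'$ with $m,n\in\mathbb{Z}$. For any such numbers, the real half-period is $$K_\kappa=\tfrac{\pi}{2}\,F\left(\tfrac14,\tfrac34;1;\kappa^2\right).$$ -/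

import Mathlib

open scoped Topology

/-- `f(T) = ∫₀ᵀ F(1/4, 3/4; 1/2; κ² sin² t) dt`, the integral being taken along the straight
segment `t = s T`, `0 ≤ s ≤ 1`. Only its germ at `T = 0` is used. -/
noncomputable def dn2Integral (κ : ℝ) (T : ℂ) : ℂ :=
  ∫ s in (0 : ℝ)..1,
    T * ₂F₁ (1 / 4 : ℂ) (3 / 4 : ℂ) (1 / 2 : ℂ) ((κ : ℂ) ^ 2 * Complex.sin ((s : ℂ) * T) ^ 2)

/-- `d` is the elliptic function `dn₂` with modulus `κ`: it is meromorphic on `ℂ` and near `0` it is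
`cos ψ`, where `φ` is the local analytic inverse of `f` with `φ(0) = 0`, and `ψ` is analytic with
`ψ(0) = 0` and `sin ψ = κ sin φ`. (Normal form: removable singularities are removed and the
value at a pole is `0`, so that `d` is determined as a function `ℂ → ℂ`.) -/
structure IsDn2 (κ : ℝ) (d : ℂ → ℂ) : Prop where
  meromorphic : MeromorphicNFOn d Set.univ
  germ : ∃ φ ψ : ℂ → ℂ,
    AnalyticAt ℂ φ 0 ∧ φ 0 = 0 ∧ (∀ᶠ z in 𝓝 0, dn2Integral κ (φ z) = z) ∧
    AnalyticAt ℂ ψ 0 ∧ ψ 0 = 0 ∧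
    (∀ᶠ z in 𝓝 0, Complex.sin (ψ z) = κ * Complex.sin (φ z)) ∧
    (∀ᶠ z in 𝓝 0, d z = Complex.cos (ψ z))

/-- `2K` and `2iK'` are fundamental periods of `d`, with `K > 0` and `K' > 0`: the periods of `d`
are precisely their integer linear combinations. -/
structure IsFundamentalHalfPeriods (d : ℂ → ℂ) (K K' : ℝ) : Prop where
  pos : 0 < K
  pos' : 0 < K'
  periodic_iff : ∀ w : ℂ, Function.Periodic d w ↔
    ∃ m n : ℤ, w = m * (2 * (K : ℂ)) + n * (2 * (K' : ℂ) * Complex.I)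

/-!
Put `f(T) = ∫₀ᵀ F(1/4, 3/4; 1/2; κ² sin² t) dt` and `Δ(T) = √(1 - κ² sin² T)`. The integrand `F` is
the algebraic function determined by `2 Δ² F² = 1 + Δ`, so `W = 1 - Δ`, regarded as a function of
the coordinate `f`, satisfies `(W')² = W (2κ² - 4W + 2W²)`. A nonconstant solution of this equation
vanishing at `0` is unique; hence it satisfies a duplication formula `W(2z) = R(W(z))` with `R`
rational, which continues it meromorphically to `ℂ`. This gives `dn₂ = 1 - W`.

Along the real axis `dn₂(f(x)) = Δ(x)` by analytic continuation, and uniqueness for the same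
equation gives `dn₂(i y) = 1 / cos² θ` along the imaginary axis, for an explicit increasing function
`y` of `θ`. On either axis the value `dn₂(0) = 1` recurs exactly at the integer multiples of one
number, which is a period. Since `dn₂` commutes with complex conjugation, every period is half an
integer combination of these two, and `dn₂(K) ≠ dn₂(i K')` excludes the extra half-periods.
Integrating `F` termwise over `[0, π]` evaluates the real period.
-/

open Filter Set
open scoped ComplexConjugate

/-! ### The identity theorem for meromorphic functions in normal form -/

section Identity

variable {𝕜 E : Type*} [NontriviallyNormedField 𝕜] [NormedAddCommGroup E] [NormedSpace 𝕜 E]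
  {f g : 𝕜 → E} {U : Set 𝕜} {x y : 𝕜}

theorem meromorphicOn_eventuallyEq_nhdsNE_of_isPreconnected (hf : MeromorphicOn f U)
    (hg : MeromorphicOn g U) (hU : IsPreconnected U) (hx : x ∈ U) (hy : y ∈ U)
    (hfg : ∃ᶠ z in 𝓝[≠] x, f z = g z) : f =ᶠ[𝓝[≠] y] g := by
  have horder : meromorphicOrderAt (f - g) x = ⊤ := by
    rw [meromorphicOrderAt_eq_top_iff]
    exact eventuallyEq_iff_sub.1 (((hf x hx).frequently_eq_iff_eventuallyEq (hg x hx)).1 hfg)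
  rw [eventuallyEq_iff_sub, EventuallyEq]
  simp only [Pi.zero_apply]
  rw [← meromorphicOrderAt_eq_top_iff]
  by_contra hne
  exact (hf.sub hg).meromorphicOrderAt_ne_top_of_isPreconnected hU hy hx hne horder

theorem meromorphicNFOn_eqOn_of_isPreconnected (hf : MeromorphicNFOn f U)
    (hg : MeromorphicNFOn g U) (hU : IsPreconnected U) (hx : x ∈ U)
    (hfg : ∃ᶠ z in 𝓝[≠] x, f z = g z) : EqOn f g U := fun _ hy =>
  (((hf hy).eventuallyEq_nhdsNE_iff_eventuallyEq_nhds (hg hy)).1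
    (meromorphicOn_eventuallyEq_nhdsNE_of_isPreconnected hf.meromorphicOn hg.meromorphicOn hU hx hy
      hfg)).eq_of_nhds

theorem meromorphicNFOn_eqOn_of_eventuallyEq (hf : MeromorphicNFOn f U)
    (hg : MeromorphicNFOn g U) (hU : IsPreconnected U) (hx : x ∈ U) (hfg : f =ᶠ[𝓝 x] g) :
    EqOn f g U :=
  meromorphicNFOn_eqOn_of_isPreconnected hf hg hU hx
    (Eventually.frequently (hfg.filter_mono nhdsWithin_le_nhds))

end Identity

theorem meromorphicNFOn_eq_of_eq_on_line {f g : ℂ → ℂ} (hf : MeromorphicNFOn f univ)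
    (hg : MeromorphicNFOn g univ) {c : ℂ} (hc : c ≠ 0) (hfg : ∀ x : ℝ, f (c * x) = g (c * x)) :
    f = g := by
  have hline : Tendsto (fun x : ℝ => c * (x : ℂ)) (𝓝[≠] 0) (𝓝[≠] 0) := by
    refine tendsto_nhdsWithin_iff.2 ⟨?_, ?_⟩
    · have hcont : Continuous fun x : ℝ => c * (x : ℂ) := by fun_prop
      simpa using (hcont.tendsto 0).mono_left nhdsWithin_le_nhds
    · filter_upwards [self_mem_nhdsWithin] with x hx
      simpa [hc] using hx
  rw [← eqOn_univ]
  exact meromorphicNFOn_eqOn_of_isPreconnected hf hg isPreconnected_univ (mem_univ 0)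
    (hline.frequently (Frequently.of_forall hfg))

theorem periodic_of_periodic_on_line {f : ℂ → ℂ} (hf : MeromorphicNFOn f univ) {c ω : ℂ}
    (hc : c ≠ 0) (hfω : ∀ x : ℝ, f (c * x + ω) = f (c * x)) : Function.Periodic f ω := by
  have hshift : MeromorphicNFOn (fun z => f (z + ω)) univ := fun z _ =>
    (hf (mem_univ (z + ω))).comp_analyticAt (g := fun z => z + ω) (by fun_prop)
  exact congrFun (meromorphicNFOn_eq_of_eq_on_line hshift hf hc hfω)

theorem analyticAt_conj_comp_conj {f : ℂ → ℂ} {x : ℂ} (hf : AnalyticAt ℂ f (conj x)) :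
    AnalyticAt ℂ (fun z => conj (f (conj z))) x := by
  rw [Complex.analyticAt_iff_eventually_differentiableAt] at hf ⊢
  filter_upwards [Complex.continuous_conj.continuousAt.eventually hf] with z hz
  simpa [Function.comp_def] using! hz.conj_conj

theorem meromorphicNFAt_conj_comp_conj {f : ℂ → ℂ} {x : ℂ} (hf : MeromorphicNFAt f (conj x)) :
    MeromorphicNFAt (fun z => conj (f (conj z))) x := by
  have hconj := Complex.continuous_conj.continuousAt (x := x)
  rcases hf with hzero | ⟨n, g, hg, hgx, hfg⟩
  · left
    filter_upwards [hconj.eventually hzero] with z hz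
    simp [hz]
  · right
    refine ⟨n, _, analyticAt_conj_comp_conj hg, by simpa using hgx, ?_⟩
    filter_upwards [hconj.eventually hfg] with z hz
    simp [hz]

theorem conj_apply_conj_of_real_on_line {f : ℂ → ℂ} (hf : MeromorphicNFOn f univ)
    (hreal : ∀ x : ℝ, conj (f x) = f x) (z : ℂ) : conj (f (conj z)) = f z := by
  refine congrFun (meromorphicNFOn_eq_of_eq_on_line
    (fun z _ => meromorphicNFAt_conj_comp_conj (hf (mem_univ (conj z)))) hf one_ne_zero
    fun x => ?_) z
  simpa using hreal x

/-! ### Meromorphic continuation by a multiplication formula -/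

section Continuation

variable {u : ℂ → ℂ}

open Metric

theorem exists_meromorphicNFOn_univ_of_forall_ball
    (hu : ∀ r : ℝ, ∃ g : ℂ → ℂ, MeromorphicNFOn g (ball 0 r) ∧ g =ᶠ[𝓝 0] u) :
    ∃ g : ℂ → ℂ, MeromorphicNFOn g univ ∧ g =ᶠ[𝓝 0] u := by
  choose g hg hgu using hu
  have hcompat : ∀ {r s : ℝ}, r ≤ s → EqOn (g r) (g s) (ball 0 r) := by
    intro r s hrs
    rcases le_or_gt r 0 with hr | hr
    · simp [ball_eq_empty.2 hr]
    · exact meromorphicNFOn_eqOn_of_eventuallyEq (hg r) (fun z hz => hg s (ball_subset_ball hrs hz))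
        (convex_ball _ _).isPreconnected (mem_ball_self hr) ((hgu r).trans (hgu s).symm)
  have hglue : ∀ r : ℝ, EqOn (fun z => g (‖z‖ + 1) z) (g r) (ball 0 r) := by
    intro r z hz
    rcases le_total (‖z‖ + 1) r with h | h
    · exact hcompat h (by simp)
    · exact (hcompat h hz).symm
  refine ⟨fun z => g (‖z‖ + 1) z, fun z _ => ?_,
    ((hglue 1).eventuallyEq_of_mem (ball_mem_nhds 0 one_pos)).trans (hgu 1)⟩
  have hz : z ∈ ball (0 : ℂ) (‖z‖ + 1) := by simp
  rw [meromorphicNFAt_congr ((hglue _).eventuallyEq_of_mem (isOpen_ball.mem_nhds hz))]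
  exact hg _ hz

variable {R : ℂ → ℂ} {q : ℂ}

theorem exists_meromorphicNFOn_ball_norm_mul (hu : AnalyticAt ℂ u 0)
    (hR : ∀ (f : ℂ → ℂ) (x : ℂ), MeromorphicAt f x → MeromorphicAt (fun z => R (f z)) x)
    (hq : q ≠ 0) (huR : ∀ᶠ z in 𝓝 0, u (q * z) = R (u z)) {r : ℝ} (hr : 0 < r)
    (hext : ∃ g : ℂ → ℂ, MeromorphicNFOn g (ball 0 r) ∧ g =ᶠ[𝓝 0] u) :
    ∃ g : ℂ → ℂ, MeromorphicNFOn g (ball 0 (‖q‖ * r)) ∧ g =ᶠ[𝓝 0] u := by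
  obtain ⟨g, hg, hgu⟩ := hext
  have hqpos : 0 < ‖q‖ := norm_pos_iff.2 hq
  have hdiv : Tendsto (fun z : ℂ => z / q) (𝓝 0) (𝓝 0) := by
    simpa using (continuous_id.div_const q).tendsto (0 : ℂ)
  have hmero : MeromorphicOn (fun z => R (g (z / q))) (ball 0 (‖q‖ * r)) := by
    intro z hz
    have hzq : z / q ∈ ball (0 : ℂ) r := by
      simp only [mem_ball_zero_iff, norm_div] at hz ⊢
      exact (div_lt_iff₀' hqpos).2 hz
    exact (hR g _ (hg hzq).meromorphicAt).comp_analyticAt (g := fun z : ℂ => z / q) (by fun_prop)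
  have hgerm : ∀ᶠ z in 𝓝 0, R (g (z / q)) = u z := by
    filter_upwards [hdiv.eventually hgu, hdiv.eventually huR] with z hz hzR
    rw [hz, ← hzR, mul_div_cancel₀ z hq]
  have hzero : (0 : ℂ) ∈ ball (0 : ℂ) (‖q‖ * r) := mem_ball_self (mul_pos hqpos hr)
  refine ⟨_, meromorphicNFOn_toMeromorphicNFOn (fun z => R (g (z / q))) _, ?_⟩
  refine ((meromorphicNFOn_toMeromorphicNFOn _ _ hzero).eventuallyEq_nhdsNE_iff_eventuallyEq_nhds
    hu.meromorphicNFAt).1 ?_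
  exact (hmero.toMeromorphicNFOn_eq_self_on_nhdsNE hzero).trans
    (hgerm.filter_mono nhdsWithin_le_nhds)

theorem exists_meromorphicNFOn_univ_of_multiplication (hu : AnalyticAt ℂ u 0)
    (hR : ∀ (f : ℂ → ℂ) (x : ℂ), MeromorphicAt f x → MeromorphicAt (fun z => R (f z)) x)
    (hq : 1 < ‖q‖) (huR : ∀ᶠ z in 𝓝 0, u (q * z) = R (u z)) :
    ∃ g : ℂ → ℂ, MeromorphicNFOn g univ ∧ g =ᶠ[𝓝 0] u := by
  obtain ⟨r, hr, hball⟩ := eventually_nhds_iff_ball.1 hu.eventually_analyticAt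
  have hpow : ∀ n : ℕ,
      ∃ g : ℂ → ℂ, MeromorphicNFOn g (ball 0 (‖q‖ ^ n * r)) ∧ g =ᶠ[𝓝 0] u := by
    intro n
    induction n with
    | zero => exact ⟨u, fun z hz => (hball z (by simpa using hz)).meromorphicNFAt, .rfl⟩
    | succ n ih =>
      rw [pow_succ', mul_assoc]
      exact exists_meromorphicNFOn_ball_norm_mul hu hR (norm_pos_iff.1 (one_pos.trans hq)) huR
        (by positivity) ih
  refine exists_meromorphicNFOn_univ_of_forall_ball fun s => ?_
  obtain ⟨n, hn⟩ := pow_unbounded_of_one_lt (s / r) hq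
  obtain ⟨g, hg, hgu⟩ := hpow n
  exact ⟨g, fun z hz => hg (ball_subset_ball ((div_lt_iff₀ hr).1 hn).le hz), hgu⟩

end Continuation

/-! ### The differential equation of elliptic functions -/

theorem eventually_eq_zero_of_deriv_deriv_eq_mul {e c : ℂ → ℂ} {x : ℂ} (he : AnalyticAt ℂ e x)
    (hc : AnalyticAt ℂ c x) (hex : e x = 0) (hex' : deriv e x = 0)
    (hode : ∀ᶠ z in 𝓝 x, deriv (deriv e) z = c z * e z) : ∀ᶠ z in 𝓝 x, e z = 0 := by
  have horder := he.analyticOrderAt_deriv_add_one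
  have horder' := he.deriv.analyticOrderAt_deriv_add_one
  have hmul : deriv (deriv e) =ᶠ[𝓝 x] c * e := hode
  simp only [hex, hex', sub_zero] at horder horder'
  rw [analyticOrderAt_congr hmul, analyticOrderAt_mul hc he] at horder'
  rw [← horder'] at horder
  -- The order `N` of `e` satisfies `N = ord c + N + 2`.
  rw [← analyticOrderAt_eq_top]
  cases hN : analyticOrderAt e x with
  | top => rfl
  | coe N =>
    rw [hN] at horder
    cases hM : analyticOrderAt c x with
    | top => simp [hM] at horder
    | coe M => rw [hM] at horder; norm_cast at horder; omega

theorem deriv_deriv_eq_of_sq_deriv_eq {u P P' : ℂ → ℂ} {x : ℂ} (hu : AnalyticAt ℂ u x)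
    (hP : ∀ y, HasDerivAt P (P' y) y) (hP' : AnalyticAt ℂ P' (u x))
    (hode : ∀ᶠ z in 𝓝 x, deriv u z ^ 2 = P (u z)) (hne : ¬ ∀ᶠ z in 𝓝 x, u z = u x) :
    ∀ᶠ z in 𝓝 x, deriv (deriv u) z = P' (u z) / 2 := by
  have hderiv_ne : ∀ᶠ z in 𝓝[≠] x, deriv u z ≠ 0 := by
    refine hu.deriv.eventually_eq_zero_or_eventually_ne_zero.resolve_left fun hzero => hne ?_
    have horder := hu.analyticOrderAt_deriv_add_one
    rw [analyticOrderAt_eq_top.2 hzero, top_add] at horder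
    filter_upwards [analyticOrderAt_eq_top.1 horder.symm] with z hz using sub_eq_zero.1 hz
  refine (hu.deriv.deriv.frequently_eq_iff_eventually_eq (hP'.comp hu).div_const).1
    (Eventually.frequently ?_)
  filter_upwards [hderiv_ne, hode.eventually_nhds.filter_mono nhdsWithin_le_nhds,
    hu.eventually_analyticAt.filter_mono nhdsWithin_le_nhds] with z hz hode_z hu_z
  have hleft : HasDerivAt (fun z => deriv u z ^ 2) (2 * deriv u z * deriv (deriv u) z) z := by
    simpa using! hu_z.deriv.differentiableAt.hasDerivAt.pow 2
  have hright : HasDerivAt (fun z => P (u z)) (P' (u z) * deriv u z) z :=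
    (hP (u z)).comp z hu_z.differentiableAt.hasDerivAt
  have hboth := hleft.unique (hright.congr_of_eventuallyEq hode_z)
  rw [Function.comp_apply, eq_div_iff two_ne_zero]
  exact mul_right_cancel₀ hz (by linear_combination hboth)

/-- `W` is the germ at `0` of a nonconstant solution of `(dW/dτ)² = W (α + β W + γ W²)` vanishing
at `0`, written in a local coordinate `τ` at `0`. -/
structure IsCubicGerm (α β γ : ℂ) (τ W : ℂ → ℂ) : Prop where
  analyticAt_coord : AnalyticAt ℂ τ 0
  coord_zero : τ 0 = 0
  deriv_coord_ne_zero : deriv τ 0 ≠ 0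
  analyticAt : AnalyticAt ℂ W 0
  map_zero : W 0 = 0
  sq_deriv : ∀ᶠ z in 𝓝 0, deriv W z ^ 2 = deriv τ z ^ 2 * (W z * (α + β * W z + γ * W z ^ 2))
  ne_zero : ¬ ∀ᶠ z in 𝓝 0, W z = 0

theorem map_nhds_zero_of_deriv_ne_zero {τ : ℂ → ℂ} (hτ : AnalyticAt ℂ τ 0) (hτ₀ : τ 0 = 0)
    (hτ' : deriv τ 0 ≠ 0) : map τ (𝓝 0) = 𝓝 0 := by
  simpa only [hτ₀] using hτ.hasStrictDerivAt.map_nhds_eq hτ'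

theorem exists_analyticAt_local_inverse {τ : ℂ → ℂ} (hτ : AnalyticAt ℂ τ 0) (hτ₀ : τ 0 = 0)
    (hτ' : deriv τ 0 ≠ 0) :
    ∃ χ : ℂ → ℂ, AnalyticAt ℂ χ 0 ∧ χ 0 = 0 ∧ (∀ᶠ z in 𝓝 0, τ (χ z) = z) ∧
      ∀ᶠ z in 𝓝 0, χ (τ z) = z := by
  have hleft := HasStrictDerivAt.eventually_left_inverse hτ.hasStrictDerivAt hτ'
  refine ⟨_, by simpa only [hτ₀] using hτ.analyticAt_localInverse hτ', ?_,
    by simpa only [hτ₀] using HasStrictDerivAt.eventually_right_inverse hτ.hasStrictDerivAt hτ',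
    hleft⟩
  simpa only [hτ₀] using hleft.self_of_nhds

/-- The right-hand side of the doubling formula `u (2 z) = R (u z)` for the solutions of
`(u')² = u (α + β u + γ u²)` vanishing at `0`. -/
noncomputable def cubicDoubling (α β γ x : ℂ) : ℂ :=
  4 * α * x * (α + β * x + γ * x ^ 2) / (α - γ * x ^ 2) ^ 2

theorem hasDerivAt_cubicDoubling {α β γ x : ℂ} (hx : α - γ * x ^ 2 ≠ 0) :
    HasDerivAt (cubicDoubling α β γ) (4 * α * (α ^ 2 + 2 * α * β * x + 6 * α * γ * x ^ 2 +
      2 * β * γ * x ^ 3 + γ ^ 2 * x ^ 4) / (α - γ * x ^ 2) ^ 3) x := by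
  have hid := hasDerivAt_id x
  have hnum := (hid.const_mul (4 * α)).mul
    (((hid.const_mul β).const_add α).add ((hid.pow 2).const_mul γ))
  have hden := (((hid.pow 2).const_mul γ).const_sub α).pow 2
  refine (hnum.div hden (pow_ne_zero 2 hx)).congr_deriv ?_
  simp only [Pi.mul_apply, Pi.add_apply, Pi.pow_apply, id]
  generalize hD : α - γ * x ^ 2 = D at hx ⊢
  field_simp
  rw [← hD]
  ring

theorem sq_deriv_cubicDoubling_mul {α β γ x : ℂ} (hx : α - γ * x ^ 2 ≠ 0) :
    deriv (cubicDoubling α β γ) x ^ 2 * (x * (α + β * x + γ * x ^ 2)) =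
      2 ^ 2 * (cubicDoubling α β γ x *
        (α + β * cubicDoubling α β γ x + γ * cubicDoubling α β γ x ^ 2)) := by
  rw [(hasDerivAt_cubicDoubling hx).deriv, cubicDoubling]
  generalize hD : α - γ * x ^ 2 = D at hx ⊢
  field_simp
  rw [← hD]
  ring

namespace IsCubicGerm

variable {α β γ : ℂ} {τ u v W : ℂ → ℂ}

theorem sq_deriv_id (hu : IsCubicGerm α β γ id u) :
    ∀ᶠ z in 𝓝 0, deriv u z ^ 2 = u z * (α + β * u z + γ * u z ^ 2) := by
  simpa using hu.sq_deriv

theorem deriv_deriv (hu : IsCubicGerm α β γ id u) :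
    ∀ᶠ z in 𝓝 0, deriv (deriv u) z = (α + 2 * β * u z + 3 * γ * u z ^ 2) / 2 := by
  have hP : ∀ x : ℂ, HasDerivAt (fun x : ℂ => x * (α + β * x + γ * x ^ 2))
      (α + 2 * β * x + 3 * γ * x ^ 2) x := by
    intro x
    have hid := hasDerivAt_id x
    refine (hid.mul (((hid.const_mul β).const_add α).add ((hid.pow 2).const_mul γ))).congr_deriv ?_
    simp only [Pi.add_apply, Pi.pow_apply, id]
    ring
  exact deriv_deriv_eq_of_sq_deriv_eq hu.analyticAt hP (by fun_prop) hu.sq_deriv_id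
    (by simpa only [hu.map_zero] using hu.ne_zero)

theorem deriv_zero (hu : IsCubicGerm α β γ id u) : deriv u 0 = 0 := by
  simpa [hu.map_zero] using hu.sq_deriv_id.self_of_nhds

theorem eventuallyEq (hu : IsCubicGerm α β γ id u) (hv : IsCubicGerm α β γ id v) :
    u =ᶠ[𝓝 0] v := by
  have hua := hu.analyticAt
  have hva := hv.analyticAt
  have hderiv : deriv (u - v) =ᶠ[𝓝 0] deriv u - deriv v := by
    filter_upwards [hua.eventually_analyticAt, hva.eventually_analyticAt] with z hu_z hv_z
    exact deriv_sub hu_z.differentiableAt hv_z.differentiableAt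
  have hode : ∀ᶠ z in 𝓝 0,
      deriv (deriv (u - v)) z = (2 * β + 3 * γ * (u z + v z)) / 2 * (u - v) z := by
    filter_upwards [hderiv.deriv, hu.deriv_deriv, hv.deriv_deriv,
      hua.deriv.eventually_analyticAt, hva.deriv.eventually_analyticAt]
      with z hz hu_z hv_z hu'_z hv'_z
    rw [hz, deriv_sub hu'_z.differentiableAt hv'_z.differentiableAt, hu_z, hv_z, Pi.sub_apply]
    ring
  have hzero := eventually_eq_zero_of_deriv_deriv_eq_mul (hua.sub hva) (by fun_prop)
    (by simp [hu.map_zero, hv.map_zero])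
    (by rw [hderiv.eq_of_nhds, Pi.sub_apply, hu.deriv_zero, hv.deriv_zero, sub_zero]) hode
  filter_upwards [hzero] with z hz using sub_eq_zero.1 hz

theorem map_nhds_coord (hW : IsCubicGerm α β γ τ W) : map τ (𝓝 0) = 𝓝 0 :=
  map_nhds_zero_of_deriv_ne_zero hW.analyticAt_coord hW.coord_zero hW.deriv_coord_ne_zero

theorem analyticAt_of_comp (hW : IsCubicGerm α β γ τ W) (hu : u ∘ τ =ᶠ[𝓝 0] W) :
    AnalyticAt ℂ u 0 := by
  simpa only [hW.coord_zero] using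
    (analyticAt_comp_iff_of_deriv_ne_zero hW.analyticAt_coord hW.deriv_coord_ne_zero).1
      (hW.analyticAt.congr hu.symm)

theorem of_comp (hW : IsCubicGerm α β γ τ W) (hu : u ∘ τ =ᶠ[𝓝 0] W) : IsCubicGerm α β γ id u where
  analyticAt_coord := analyticAt_id
  coord_zero := rfl
  deriv_coord_ne_zero := by simp
  analyticAt := hW.analyticAt_of_comp hu
  map_zero := by simpa [hW.coord_zero, hW.map_zero] using hu.eq_of_nhds
  sq_deriv := by
    have hode : ∀ᶠ z in 𝓝 0,
        deriv u (τ z) ^ 2 = u (τ z) * (α + β * u (τ z) + γ * u (τ z) ^ 2) := by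
      have hτ := hW.analyticAt_coord
      have hτ_tendsto : Tendsto τ (𝓝 0) (𝓝 0) := hW.map_nhds_coord.le
      filter_upwards [hW.sq_deriv, hu, hu.deriv, hτ.eventually_analyticAt,
        hτ_tendsto.eventually (hW.analyticAt_of_comp hu).eventually_analyticAt,
        hτ.deriv.continuousAt.eventually_ne hW.deriv_coord_ne_zero]
        with z hode hz hz' hτ_z hu_z hne
      rw [deriv_comp z hu_z.differentiableAt hτ_z.differentiableAt] at hz'
      rw [← hz', ← hz, mul_pow, mul_comm] at hode
      exact mul_left_cancel₀ (pow_ne_zero 2 hne) hode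
    rw [← hW.map_nhds_coord, eventually_map]
    simpa using hode
  ne_zero := fun hzero => hW.ne_zero <| by
    rw [← hW.map_nhds_coord, eventually_map] at hzero
    filter_upwards [hu, hzero] with z hz hz₀
    rw [← hz, Function.comp_apply, hz₀]

theorem comp_eventuallyEq (hu : IsCubicGerm α β γ id u) (hW : IsCubicGerm α β γ τ W) :
    u ∘ τ =ᶠ[𝓝 0] W := by
  obtain ⟨χ, -, -, -, hχτ⟩ := exists_analyticAt_local_inverse hW.analyticAt_coord hW.coord_zero
    hW.deriv_coord_ne_zero
  have hWχ : (W ∘ χ) ∘ τ =ᶠ[𝓝 0] W := by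
    filter_upwards [hχτ] with z hz
    simp only [Function.comp_apply, hz]
  have hτ_tendsto : Tendsto τ (𝓝 0) (𝓝 0) := hW.map_nhds_coord.le
  exact ((hu.eventuallyEq (hW.of_comp hWχ)).comp_tendsto hτ_tendsto).trans hWχ

theorem eventually_denom_ne_zero (hu : IsCubicGerm α β γ id u) (hα : α ≠ 0) :
    ∀ᶠ z in 𝓝 0, α - γ * u z ^ 2 ≠ 0 := by
  have hua := hu.analyticAt.continuousAt
  exact ContinuousAt.eventually_ne (g := fun z => α - γ * u z ^ 2) (by fun_prop)
    (by simpa [hu.map_zero] using hα)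

theorem cubicDoubling_comp (hu : IsCubicGerm α β γ id u) (hα : α ≠ 0) :
    IsCubicGerm α β γ (fun z => 2 * z) (cubicDoubling α β γ ∘ u) where
  analyticAt_coord := by fun_prop
  coord_zero := mul_zero 2
  deriv_coord_ne_zero := by simp
  analyticAt := by
    have hua := hu.analyticAt
    have hden := (hu.eventually_denom_ne_zero hα).self_of_nhds
    simp only [cubicDoubling, Function.comp_def]
    fun_prop (disch := exact pow_ne_zero 2 hden)
  map_zero := by simp [cubicDoubling, hu.map_zero]
  sq_deriv := by
    filter_upwards [hu.sq_deriv_id, hu.eventually_denom_ne_zero hα,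
      hu.analyticAt.eventually_analyticAt] with z hode hden hu_z
    rw [deriv_comp z (hasDerivAt_cubicDoubling hden).differentiableAt hu_z.differentiableAt,
      mul_pow, hode, Function.comp_apply, sq_deriv_cubicDoubling_mul hden]
    simp
  ne_zero := fun hzero => hu.ne_zero <| by
    have hua := hu.analyticAt.continuousAt
    have hnum : ∀ᶠ z in 𝓝 0, α + β * u z + γ * u z ^ 2 ≠ 0 :=
      ContinuousAt.eventually_ne (g := fun z => α + β * u z + γ * u z ^ 2) (by fun_prop)
        (by simpa [hu.map_zero] using hα)
    filter_upwards [hzero, hu.eventually_denom_ne_zero hα, hnum] with z hz hden hnum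
    simpa [cubicDoubling, hα, hden, hnum] using hz

theorem doubling (hu : IsCubicGerm α β γ id u) (hα : α ≠ 0) :
    ∀ᶠ z in 𝓝 0, u (2 * z) = cubicDoubling α β γ (u z) :=
  hu.comp_eventuallyEq (hu.cubicDoubling_comp hα)

end IsCubicGerm

/-! ### The hypergeometric function -/

section PowerSeries

variable {𝕂 : Type*} [RCLike 𝕂] {a b c x : 𝕂}

theorem hasFPowerSeriesOnBall_ordinaryHypergeometric
    (habc : ∀ k : ℕ, (k : 𝕂) ≠ -a ∧ (k : 𝕂) ≠ -b ∧ (k : 𝕂) ≠ -c) :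
    HasFPowerSeriesOnBall (₂F₁ a b c : 𝕂 → 𝕂) (ordinaryHypergeometricSeries 𝕂 a b c) 0 1 := by
  have hradius := ordinaryHypergeometricSeries_radius_eq_one 𝕂 a b c habc
  exact hradius ▸ (ordinaryHypergeometricSeries 𝕂 a b c).hasFPowerSeriesOnBall
    (hradius.symm ▸ one_pos)

theorem hasSum_ordinaryHypergeometric
    (habc : ∀ k : ℕ, (k : 𝕂) ≠ -a ∧ (k : 𝕂) ≠ -b ∧ (k : 𝕂) ≠ -c) (hx : ‖x‖ < 1) :
    HasSum (fun n => ordinaryHypergeometricCoefficient a b c n * x ^ n) (₂F₁ a b c x) := by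
  have hsum := (hasFPowerSeriesOnBall_ordinaryHypergeometric habc).hasSum (y := x)
    (by simpa [enorm_eq_nnnorm, ← NNReal.coe_lt_one] using hx)
  simpa only [ordinaryHypergeometricSeries_apply_eq, smul_eq_mul, zero_add] using hsum

theorem analyticAt_ordinaryHypergeometric
    (habc : ∀ k : ℕ, (k : 𝕂) ≠ -a ∧ (k : 𝕂) ≠ -b ∧ (k : 𝕂) ≠ -c) (hx : ‖x‖ < 1) :
    AnalyticAt 𝕂 (₂F₁ a b c : 𝕂 → 𝕂) x :=
  (hasFPowerSeriesOnBall_ordinaryHypergeometric habc).analyticAt_of_mem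
    (by simpa [enorm_eq_nnnorm, ← NNReal.coe_lt_one] using hx)

end PowerSeries

section Real

variable {a b c x : ℝ}

theorem ofReal_ordinaryHypergeometric (a b c x : ℝ) :
    ((₂F₁ a b c x : ℝ) : ℂ) = ₂F₁ (a : ℂ) (b : ℂ) (c : ℂ) (x : ℂ) := by
  have hascPochhammer (n : ℕ) (t : ℝ) :
      (ascPochhammer ℂ n).eval (t : ℂ) = ((ascPochhammer ℝ n).eval t : ℝ) := by
    rw [← ascPochhammer_map Complex.ofRealHom n, Polynomial.eval_map]
    exact Polynomial.eval₂_at_apply Complex.ofRealHom t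
  simp only [ordinaryHypergeometric_eq_tsum, Complex.ofReal_tsum, hascPochhammer, smul_eq_mul]
  push_cast
  rfl

theorem natCast_ne_neg_of_pos (hx : 0 < x) (k : ℕ) : (k : ℝ) ≠ -x := by
  have := k.cast_nonneg (α := ℝ)
  linarith

theorem analyticAt_ordinaryHypergeometric_of_pos (ha : 0 < a) (hb : 0 < b) (hc : 0 < c) {z : ℂ}
    (hz : ‖z‖ < 1) : AnalyticAt ℂ (₂F₁ (a : ℂ) (b : ℂ) (c : ℂ) : ℂ → ℂ) z :=
  have hne {x : ℝ} (hx : 0 < x) (k : ℕ) : (k : ℂ) ≠ -x := mod_cast natCast_ne_neg_of_pos hx k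
  analyticAt_ordinaryHypergeometric (fun k => ⟨hne ha k, hne hb k, hne hc k⟩) hz

theorem ordinaryHypergeometricCoefficient_pos (ha : 0 < a) (hb : 0 < b) (hc : 0 < c) (n : ℕ) :
    0 < ordinaryHypergeometricCoefficient a b c n := by
  have := ascPochhammer_pos n a ha
  have := ascPochhammer_pos n b hb
  have := ascPochhammer_pos n c hc
  unfold ordinaryHypergeometricCoefficient
  positivity

theorem ordinaryHypergeometric_pos (ha : 0 < a) (hb : 0 < b) (hc : 0 < c) (hx₀ : 0 ≤ x)
    (hx₁ : x < 1) : 0 < ₂F₁ a b c x := by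
  have hsum := hasSum_ordinaryHypergeometric (a := a) (b := b) (c := c) (x := x)
    (fun k => ⟨natCast_ne_neg_of_pos ha k, natCast_ne_neg_of_pos hb k, natCast_ne_neg_of_pos hc k⟩)
    (by rwa [Real.norm_of_nonneg hx₀])
  have hnonneg (n : ℕ) : 0 ≤ ordinaryHypergeometricCoefficient a b c n * x ^ n :=
    mul_nonneg (ordinaryHypergeometricCoefficient_pos ha hb hc n).le (pow_nonneg hx₀ n)
  exact hsum.tsum_eq ▸ hsum.summable.tsum_pos hnonneg 0
    (by simp [ordinaryHypergeometricCoefficient])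

end Real

section Quadratic

variable {K : Type*} [Field K] [CharZero K]

theorem ascPochhammer_eval_two_mul (a : K) (n : ℕ) :
    (ascPochhammer K (2 * n)).eval (2 * a) =
      4 ^ n * (ascPochhammer K n).eval a * (ascPochhammer K n).eval (a + 1 / 2) := by
  induction n with
  | zero => simp
  | succ n ih =>
    rw [show 2 * (n + 1) = 2 * n + 1 + 1 by ring]
    simp only [ascPochhammer_succ_eval, ih]
    push_cast
    ring

theorem factorial_two_mul_eq_ascPochhammer (n : ℕ) :
    ((2 * n).factorial : K) = 4 ^ n * (ascPochhammer K n).eval (1 / 2) * n.factorial := by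
  have hdup := ascPochhammer_eval_two_mul (1 / 2 : K) n
  rwa [mul_one_div_cancel two_ne_zero, add_halves, ascPochhammer_eval_one,
    ascPochhammer_eval_one] at hdup

theorem ascPochhammer_eval_two_mul_div_factorial (a : K) (n : ℕ) :
    (ascPochhammer K (2 * n)).eval (2 * a) / (2 * n).factorial =
      ordinaryHypergeometricCoefficient a (a + 1 / 2) (1 / 2) n := by
  rw [ascPochhammer_eval_two_mul, factorial_two_mul_eq_ascPochhammer]
  unfold ordinaryHypergeometricCoefficient
  field_simp

theorem hasSum_one_div_one_sub_cpow (a : ℂ) {x : ℂ} (hx : ‖x‖ < 1) :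
    HasSum (fun n : ℕ => (ascPochhammer ℂ n).eval a / n.factorial * x ^ n)
      (1 / (1 - x) ^ a) := by
  have hsum := (Complex.one_div_one_sub_cpow_hasFPowerSeriesOnBall_zero a).hasSum (y := x)
    (by simpa [enorm_eq_nnnorm, ← NNReal.coe_lt_one] using hx)
  simp only [zero_add, FormalMultilinearSeries.ofScalars_apply_eq, smul_eq_mul] at hsum
  refine hsum.congr_fun fun n => ?_
  have hchoose := Ring.factorial_nsmul_multichoose_eq_ascPochhammer a n
  rw [Polynomial.ascPochhammer_smeval_eq_eval, Ring.multichoose_eq, nsmul_eq_mul] at hchoose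
  rw [← hchoose, mul_div_cancel_left₀ _ (Nat.cast_ne_zero.2 n.factorial_ne_zero)]

-- The series in `x ^ 2` is the even part of the binomial series of `(1 - x) ^ (-2 * a)`.
theorem ordinaryHypergeometric_add_half_sq (a : ℂ) {x : ℂ} (hx : ‖x‖ < 1) :
    ₂F₁ a (a + 1 / 2) (1 / 2 : ℂ) (x ^ 2) =
      (1 / (1 - x) ^ (2 * a) + 1 / (1 + x) ^ (2 * a)) / 2 := by
  have hsum := ((hasSum_one_div_one_sub_cpow (2 * a) hx).add
    (hasSum_one_div_one_sub_cpow (2 * a) (x := -x) (by simpa using hx))).div_const 2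
  rw [sub_neg_eq_add, ← (mul_right_injective₀ (two_ne_zero (α := ℕ))).hasSum_iff] at hsum
  · rw [ordinaryHypergeometric_eq_tsum, ← hsum.tsum_eq]
    refine tsum_congr fun n => ?_
    simp only [Function.comp_apply, smul_eq_mul, (even_two_mul n).neg_pow, add_self_div_two,
      ascPochhammer_eval_two_mul_div_factorial, pow_mul]
  · intro n hn
    have hodd : Odd n := Nat.not_even_iff_odd.1 fun ⟨k, hk⟩ => hn ⟨k, by simp [hk, two_mul]⟩
    simp [hodd.neg_pow]

theorem cpow_inv_two_mul_cpow_inv_two {z w : ℂ} (hz : 0 < z.re) (hw : 0 < w.re) :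
    z ^ (2⁻¹ : ℂ) * w ^ (2⁻¹ : ℂ) = (z * w) ^ (2⁻¹ : ℂ) := by
  have hsq (v : ℂ) : (v ^ (2⁻¹ : ℂ)) ^ 2 = v := Complex.cpow_ofNat_inv_pow v 2
  have him_lt_re {v : ℂ} (hv : 0 < v.re) : |(v ^ (2⁻¹ : ℂ)).im| < (v ^ (2⁻¹ : ℂ)).re := by
    refine abs_lt_of_sq_lt_sq ?_ (by rw [Complex.cpow_inv_two_re]; positivity)
    have hre := congrArg Complex.re (hsq v)
    rw [sq, Complex.mul_re] at hre
    linarith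
  have hre : 0 < (z ^ (2⁻¹ : ℂ) * w ^ (2⁻¹ : ℂ)).re := by
    rw [Complex.mul_re, sub_pos]
    refine (le_abs_self _).trans_lt ?_
    rw [abs_mul]
    exact mul_lt_mul'' (him_lt_re hz) (him_lt_re hw) (abs_nonneg _) (abs_nonneg _)
  rw [← Complex.sq_cpow_two_inv hre, mul_pow, hsq, hsq]

theorem two_mul_one_sub_mul_sq_ordinaryHypergeometric {s : ℂ} (hs : ‖s‖ < 1) :
    2 * (1 - s) * ₂F₁ (1 / 4 : ℂ) (3 / 4 : ℂ) (1 / 2 : ℂ) s ^ 2 = 1 + (1 - s) ^ (2⁻¹ : ℂ) := by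
  obtain ⟨x, rfl⟩ := IsAlgClosed.exists_pow_nat_eq s two_pos
  have hx : ‖x‖ < 1 := by
    rwa [norm_pow, pow_lt_one_iff_of_nonneg (norm_nonneg x) two_ne_zero] at hs
  have hre := (abs_lt.1 ((Complex.abs_re_le_norm x).trans_lt hx))
  have hsub : 0 < (1 - x).re := by simpa using hre.2
  have hadd : 0 < (1 + x).re := by simpa using neg_lt_iff_pos_add'.1 hre.1
  have hF := ordinaryHypergeometric_add_half_sq (1 / 4) hx
  norm_num only at hF
  rw [one_div (2 : ℂ)] at hF
  have hpq := cpow_inv_two_mul_cpow_inv_two hsub hadd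
  have hp : ((1 - x) ^ (2⁻¹ : ℂ)) ^ 2 = 1 - x := Complex.cpow_ofNat_inv_pow (1 - x) 2
  have hq : ((1 + x) ^ (2⁻¹ : ℂ)) ^ 2 = 1 + x := Complex.cpow_ofNat_inv_pow (1 + x) 2
  have hp₀ : (1 - x) ^ (2⁻¹ : ℂ) ≠ 0 := by
    simpa using fun h => hsub.ne' (congrArg Complex.re h)
  have hq₀ : (1 + x) ^ (2⁻¹ : ℂ) ≠ 0 := by
    simpa using fun h => hadd.ne' (congrArg Complex.re h)
  rw [one_div (2 : ℂ), hF, show 1 - x ^ 2 = (1 - x) * (1 + x) by ring, ← hpq]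
  generalize (1 - x) ^ (2⁻¹ : ℂ) = p at *
  generalize (1 + x) ^ (2⁻¹ : ℂ) = q at *
  rw [← hp, ← hq]
  field_simp
  linear_combination hp + hq

end Quadratic

section Integral

variable {a b : ℝ}

theorem ordinaryHypergeometricCoefficient_half_mul_prod (a b : ℝ) (n : ℕ) :
    ordinaryHypergeometricCoefficient a b (1 / 2) n *
      ∏ i ∈ Finset.range n, (2 * (i : ℝ) + 1) / (2 * i + 2) =
      ordinaryHypergeometricCoefficient a b 1 n := by
  have hprod : ∏ i ∈ Finset.range n, (2 * (i : ℝ) + 1) / (2 * i + 2) =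
      (ascPochhammer ℝ n).eval (1 / 2) * ((ascPochhammer ℝ n).eval 1)⁻¹ := by
    induction n with
    | zero => simp
    | succ n ih =>
      rw [Finset.prod_range_succ, ih]
      simp only [ascPochhammer_succ_eval]
      field_simp
      ring
  have := (ascPochhammer_pos n (1 / 2 : ℝ) (by norm_num)).ne'
  rw [hprod]
  unfold ordinaryHypergeometricCoefficient
  field_simp

theorem integral_ordinaryHypergeometric_mul_sin_sq
    (hab : ∀ k : ℕ, (k : ℝ) ≠ -a ∧ (k : ℝ) ≠ -b) {x : ℝ} (hx : |x| < 1) :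
    ∫ t in (0 : ℝ)..Real.pi, ₂F₁ a b (1 / 2 : ℝ) (x * Real.sin t ^ 2) =
      Real.pi * ₂F₁ a b (1 : ℝ) x := by
  have hseries {c : ℝ} (hc : 0 < c) {y : ℝ} (hy : |y| < 1) :=
    hasSum_ordinaryHypergeometric (x := y)
      (fun k => ⟨(hab k).1, (hab k).2, natCast_ne_neg_of_pos hc k⟩) hy
  have hle (t : ℝ) : |x * Real.sin t ^ 2| ≤ |x| := by
    rw [abs_mul, abs_of_nonneg (sq_nonneg (Real.sin t))]
    exact mul_le_of_le_one_right (abs_nonneg x) (Real.sin_sq_le_one t)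
  have hintegral := intervalIntegral.hasSum_integral_of_dominated_convergence
    (μ := MeasureTheory.volume) (a := 0) (b := Real.pi)
    (F := fun n t => ordinaryHypergeometricCoefficient a b (1 / 2) n * (x * Real.sin t ^ 2) ^ n)
    (fun n _ => |ordinaryHypergeometricCoefficient a b (1 / 2) n * x ^ n|)
    (fun n => Continuous.aestronglyMeasurable (by fun_prop))
    (fun n => .of_forall fun t _ => by
      rw [Real.norm_eq_abs, abs_mul _ (_ ^ n), abs_mul _ (x ^ n), abs_pow, abs_pow]
      exact mul_le_mul_of_nonneg_left (pow_le_pow_left₀ (abs_nonneg _) (hle t) n)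
        (abs_nonneg _))
    (.of_forall fun t _ => (hseries one_half_pos hx).summable.abs)
    intervalIntegrable_const
    (.of_forall fun t _ => hseries one_half_pos ((hle t).trans_lt hx))
  refine hintegral.unique (((hseries one_pos hx).mul_left Real.pi).congr_fun fun n => ?_)
  simp_rw [← ordinaryHypergeometricCoefficient_half_mul_prod a b n, mul_pow, ← pow_mul]
  rw [intervalIntegral.integral_const_mul, intervalIntegral.integral_const_mul,
    integral_sin_pow_even]
  ring

end Integral

/-! ### Functions parametrized by a primitive along the real axis -/

/-- The integral of `g` along the segment from `0` to `T`. -/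
noncomputable def segmentIntegral (g : ℂ → ℂ) (T : ℂ) : ℂ :=
  ∫ s in (0 : ℝ)..1, T * g ((s : ℂ) * T)

section SegmentIntegral

variable {g : ℂ → ℂ}

theorem segmentIntegral_zero (g : ℂ → ℂ) : segmentIntegral g 0 = 0 := by simp [segmentIntegral]

theorem segmentIntegral_eq_sub_of_hasDerivAt {G : ℂ → ℂ} {S : Set ℂ} (hS : StarConvex ℝ 0 S)
    (hG : ∀ z ∈ S, HasDerivAt G (g z) z) (hg : ContinuousOn g S) {T : ℂ} (hT : T ∈ S) :
    segmentIntegral g T = G T - G 0 := by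
  have hmem : ∀ s ∈ uIcc (0 : ℝ) 1, (s : ℂ) * T ∈ S := fun s hs => by
    rw [uIcc_of_le zero_le_one] at hs
    simpa using hS hT (sub_nonneg.2 hs.2) hs.1 (by ring)
  have hderiv : ∀ s ∈ uIcc (0 : ℝ) 1,
      HasDerivAt (fun s : ℝ => G ((s : ℂ) * T)) (T * g ((s : ℂ) * T)) s := fun s hs => by
    have hline : HasDerivAt (fun s : ℝ => (s : ℂ) * T) T s := by
      simpa using (Complex.ofRealCLM.hasDerivAt (x := s)).mul_const T
    rw [mul_comm T]
    exact (hG _ (hmem s hs)).comp s hline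
  have hcont : ContinuousOn (fun s : ℝ => T * g ((s : ℂ) * T)) (uIcc 0 1) :=
    continuousOn_const.mul (hg.comp (by fun_prop) hmem)
  rw [segmentIntegral,
    intervalIntegral.integral_eq_sub_of_hasDerivAt hderiv hcont.intervalIntegrable]
  simp

theorem hasDerivAt_segmentIntegral {S : Set ℂ} (hS : Convex ℝ S) (hSo : IsOpen S)
    (hS₀ : (0 : ℂ) ∈ S) (hg : DifferentiableOn ℂ g S) {T : ℂ} (hT : T ∈ S) :
    HasDerivAt (segmentIntegral g) (g T) T := by
  obtain ⟨G, hGwithin⟩ := hS.exists_forall_hasDerivWithinAt hg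
  have hG : ∀ z ∈ S, HasDerivAt G (g z) z := fun z hz =>
    (hGwithin z hz).hasDerivAt (hSo.mem_nhds hz)
  refine ((hG T hT).sub_const (G 0)).congr_of_eventuallyEq ?_
  filter_upwards [hSo.mem_nhds hT] with z hz
    using segmentIntegral_eq_sub_of_hasDerivAt (hS.starConvex hS₀) hG hg.continuousOn hz

theorem segmentIntegral_ofReal {γ : ℝ → ℝ} (hγ : ∀ x : ℝ, g x = γ x) (x : ℝ) :
    segmentIntegral g x = ((∫ t in (0 : ℝ)..x, γ t : ℝ) : ℂ) := by
  have hscale := intervalIntegral.mul_integral_comp_mul_right (a := 0) (b := 1) (f := γ) (c := x)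
  rw [zero_mul, one_mul] at hscale
  rw [← hscale, segmentIntegral, intervalIntegral.integral_const_mul, Complex.ofReal_mul,
    ← intervalIntegral.integral_ofReal]
  simp only [← hγ, Complex.ofReal_mul]

end SegmentIntegral

/-- The open horizontal strip of half-width `δ` around the real axis. -/
def realStrip (δ : ℝ) : Set ℂ := Complex.im ⁻¹' Ioo (-δ) δ

theorem convex_realStrip (δ : ℝ) : Convex ℝ (realStrip δ) :=
  (convex_Ioo (-δ) δ).linear_preimage Complex.imLm

theorem isOpen_realStrip (δ : ℝ) : IsOpen (realStrip δ) :=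
  isOpen_Ioo.preimage Complex.continuous_im

theorem ofReal_mem_realStrip {δ : ℝ} (hδ : 0 < δ) (x : ℝ) : (x : ℂ) ∈ realStrip δ := by
  simp [realStrip, hδ]

theorem norm_cos_le_cosh_im (z : ℂ) : ‖Complex.cos z‖ ≤ Real.cosh z.im := by
  rw [Complex.cos, Real.cosh_eq, norm_div, Complex.norm_ofNat]
  refine div_le_div_of_nonneg_right ((norm_add_le _ _).trans_eq ?_) zero_le_two
  simp [Complex.norm_exp, add_comm]

theorem norm_sin_le_cosh_im (z : ℂ) : ‖Complex.sin z‖ ≤ Real.cosh z.im := by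
  simpa [← Complex.cos_sub_pi_div_two] using norm_cos_le_cosh_im (z - Real.pi / 2)

theorem exists_realStrip_mul_cosh_pow_lt_one {r : ℝ} (hr : r < 1) (n : ℕ) :
    ∃ δ > 0, ∀ z ∈ realStrip δ, r * Real.cosh z.im ^ n < 1 := by
  have hcont : ContinuousAt (fun y : ℝ => r * Real.cosh y ^ n) 0 := by
    have := Real.continuous_cosh
    fun_prop
  obtain ⟨δ, hδ, hlt⟩ := Metric.eventually_nhds_iff.1
    (hcont.eventually_lt_const (u := 1) (by simpa using hr))
  exact ⟨δ, hδ, fun z hz => hlt (by simpa [Real.dist_eq, abs_lt, realStrip] using hz)⟩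

/-- `γ` is a positive even `T`-periodic function on the real axis and `g` extends it holomorphically
to a strip: the speed of a reparametrization `x ↦ ∫₀ˣ γ` of the line that commutes with `x ↦ -x` and
turns the period `T` into the period `∫₀ᵀ γ`. -/
structure IsHolomorphicSpeed (T : ℝ) (g : ℂ → ℂ) (γ : ℝ → ℝ) : Prop where
  exists_differentiableOn : ∃ δ > 0, DifferentiableOn ℂ g (realStrip δ)
  ofReal_eq : ∀ x : ℝ, g x = γ x
  pos : ∀ x, 0 < γ x
  period_pos : 0 < T
  periodic : Function.Periodic γ T
  even : Function.Even γ

namespace IsHolomorphicSpeed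

variable {T : ℝ} {g : ℂ → ℂ} {γ : ℝ → ℝ}

theorem analyticAt_ofReal (hγ : IsHolomorphicSpeed T g γ) (x : ℝ) : AnalyticAt ℂ g x := by
  obtain ⟨δ, hδ, hg⟩ := hγ.exists_differentiableOn
  exact hg.analyticAt ((isOpen_realStrip δ).mem_nhds (ofReal_mem_realStrip hδ x))

theorem eventually_hasDerivAt_segmentIntegral (hγ : IsHolomorphicSpeed T g γ) (x : ℝ) :
    ∀ᶠ z in 𝓝 (x : ℂ), HasDerivAt (segmentIntegral g) (g z) z := by
  obtain ⟨δ, hδ, hg⟩ := hγ.exists_differentiableOn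
  filter_upwards [(isOpen_realStrip δ).mem_nhds (ofReal_mem_realStrip hδ x)] with z hz
  exact hasDerivAt_segmentIntegral (convex_realStrip δ) (isOpen_realStrip δ)
    (ofReal_mem_realStrip hδ 0) hg hz

theorem analyticAt_segmentIntegral (hγ : IsHolomorphicSpeed T g γ) (x : ℝ) :
    AnalyticAt ℂ (segmentIntegral g) x :=
  Complex.analyticAt_iff_eventually_differentiableAt.2
    ((hγ.eventually_hasDerivAt_segmentIntegral x).mono fun _ h => h.differentiableAt)

theorem apply_zero_ne_zero (hγ : IsHolomorphicSpeed T g γ) : g 0 ≠ 0 := by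
  rw [← Complex.ofReal_zero, hγ.ofReal_eq]
  exact Complex.ofReal_ne_zero.2 (hγ.pos 0).ne'

theorem continuous (hγ : IsHolomorphicSpeed T g γ) : Continuous γ := by
  have hre : Continuous fun x : ℝ => (g x).re := continuous_iff_continuousAt.2 fun x =>
    Complex.continuous_re.continuousAt.comp
      ((hγ.analyticAt_ofReal x).continuousAt.comp Complex.continuous_ofReal.continuousAt)
  simpa only [hγ.ofReal_eq, Complex.ofReal_re] using hre

theorem intervalIntegrable (hγ : IsHolomorphicSpeed T g γ) (a b : ℝ) :
    IntervalIntegrable γ MeasureTheory.volume a b :=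
  hγ.continuous.intervalIntegrable a b

theorem integral_period_pos (hγ : IsHolomorphicSpeed T g γ) : 0 < ∫ t in (0 : ℝ)..T, γ t :=
  intervalIntegral.intervalIntegral_pos_of_pos (hγ.intervalIntegrable 0 T) hγ.pos hγ.period_pos

theorem integral_add_period (hγ : IsHolomorphicSpeed T g γ) (x : ℝ) :
    ∫ t in (0 : ℝ)..(x + T), γ t = (∫ t in (0 : ℝ)..x, γ t) + ∫ t in (0 : ℝ)..T, γ t := by
  rw [hγ.periodic.intervalIntegral_add_eq_add 0 x hγ.intervalIntegrable, zero_add]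

theorem integral_int_mul_period (hγ : IsHolomorphicSpeed T g γ) (m : ℤ) :
    ∫ t in (0 : ℝ)..(m * T), γ t = m * ∫ t in (0 : ℝ)..T, γ t := by
  simpa using hγ.periodic.intervalIntegral_add_zsmul_eq m 0 hγ.intervalIntegrable

theorem integral_half_period (hγ : IsHolomorphicSpeed T g γ) :
    ∫ t in (0 : ℝ)..(T / 2), γ t = (∫ t in (0 : ℝ)..T, γ t) / 2 := by
  have hshift := hγ.integral_add_period (-(T / 2))
  have hneg := intervalIntegral.integral_comp_neg (a := 0) (b := T / 2) γ
  simp only [hγ.even _, neg_zero, intervalIntegral.integral_symm 0 (-(T / 2))] at hneg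
  rw [show -(T / 2) + T = T / 2 by ring] at hshift
  linarith

theorem surjective_integral (hγ : IsHolomorphicSpeed T g γ) :
    Function.Surjective fun x : ℝ => ∫ t in (0 : ℝ)..x, γ t :=
  (intervalIntegral.continuous_primitive hγ.intervalIntegrable 0).surjective
    (hγ.periodic.tendsto_atTop_intervalIntegral_of_pos' (hγ.intervalIntegrable 0 T) hγ.pos
      hγ.period_pos)
    (hγ.periodic.tendsto_atBot_intervalIntegral_of_pos' (hγ.intervalIntegrable 0 T) hγ.pos
      hγ.period_pos)

variable {d : ℂ → ℂ} {c : ℂ}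

theorem apply_mul_integral_of_germ (hγ : IsHolomorphicSpeed T g γ) (hd : MeromorphicNFOn d univ)
    {h : ℂ → ℂ} (hh : ∀ x : ℝ, MeromorphicNFAt h x)
    (hgerm : ∀ᶠ θ in 𝓝 0, d (c * segmentIntegral g θ) = h θ) (x : ℝ) :
    d (c * ((∫ t in (0 : ℝ)..x, γ t : ℝ) : ℂ)) = h x := by
  have hcomp : MeromorphicNFOn (fun z => d (c * segmentIntegral g z)) (range ((↑) : ℝ → ℂ)) := by
    rintro _ ⟨y, rfl⟩
    exact (hd (mem_univ _)).comp_analyticAt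
      (analyticAt_const.mul (hγ.analyticAt_segmentIntegral y))
  have heqOn := meromorphicNFOn_eqOn_of_eventuallyEq hcomp (forall_mem_range.2 hh)
    (isPreconnected_range Complex.continuous_ofReal) ⟨0, Complex.ofReal_zero⟩ hgerm
  simpa only [segmentIntegral_ofReal hγ.ofReal_eq] using heqOn (mem_range_self x)

theorem periodic_of_apply_mul_integral (hγ : IsHolomorphicSpeed T g γ)
    (hd : MeromorphicNFOn d univ) (hc : c ≠ 0) {h : ℝ → ℂ} (hh : Function.Periodic h T)
    (hdh : ∀ x : ℝ, d (c * ((∫ t in (0 : ℝ)..x, γ t : ℝ) : ℂ)) = h x) :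
    Function.Periodic d (c * ((∫ t in (0 : ℝ)..T, γ t : ℝ) : ℂ)) := by
  refine periodic_of_periodic_on_line hd hc fun y => ?_
  obtain ⟨x, rfl⟩ := hγ.surjective_integral y
  rw [hdh, ← mul_add, ← Complex.ofReal_add, ← hγ.integral_add_period, hdh, hh x]

end IsHolomorphicSpeed

/-! ### The germ of `dn₂` -/

/-- The integrand `F(1/4, 3/4; 1/2; κ² sin² t)` of `dn2Integral`. -/
noncomputable def dn2Integrand (κ : ℝ) (t : ℂ) : ℂ :=
  ₂F₁ (1 / 4 : ℂ) (3 / 4 : ℂ) (1 / 2 : ℂ) ((κ : ℂ) ^ 2 * Complex.sin t ^ 2)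

/-- The restriction of `dn2Integrand` to the real axis, as a real function. -/
noncomputable def dn2RealSpeed (κ t : ℝ) : ℝ :=
  ₂F₁ (1 / 4 : ℝ) (3 / 4 : ℝ) (1 / 2 : ℝ) (κ ^ 2 * Real.sin t ^ 2)

/-- Jacobi's `Δ(θ) = √(1 - κ² sin² θ)` with the principal square root: `dn₂` is the function
`Δ` of `θ` expressed in the coordinate `dn2Integral κ θ`. -/
noncomputable def modularDelta (κ : ℝ) (θ : ℂ) : ℂ :=
  (1 - (κ : ℂ) ^ 2 * Complex.sin θ ^ 2) ^ (2⁻¹ : ℂ)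

theorem not_eventually_sin_eq_zero : ¬ ∀ᶠ θ in 𝓝 0, Complex.sin θ = 0 := fun hsin => by
  have hderiv : deriv Complex.sin 0 = deriv (fun _ : ℂ => (0 : ℂ)) 0 := EventuallyEq.deriv_eq hsin
  simp at hderiv

section Germ

variable {κ : ℝ}

theorem dn2Integral_eq_segmentIntegral (κ : ℝ) :
    dn2Integral κ = segmentIntegral (dn2Integrand κ) := rfl

theorem dn2Integral_zero (κ : ℝ) : dn2Integral κ 0 = 0 :=
  segmentIntegral_zero (dn2Integrand κ)

theorem sq_mul_sin_sq_lt_one (hκ : κ ^ 2 < 1) (x : ℝ) : κ ^ 2 * Real.sin x ^ 2 < 1 :=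
  (mul_le_of_le_one_right (sq_nonneg κ) (Real.sin_sq_le_one x)).trans_lt hκ

theorem exists_differentiableOn_dn2Integrand (hκ : κ ^ 2 < 1) :
    ∃ δ > 0, DifferentiableOn ℂ (dn2Integrand κ) (realStrip δ) := by
  obtain ⟨δ, hδ, hcosh⟩ := exists_realStrip_mul_cosh_pow_lt_one hκ 2
  refine ⟨δ, hδ, fun z hz => DifferentiableAt.differentiableWithinAt ?_⟩
  have hnorm : ‖(κ : ℂ) ^ 2 * Complex.sin z ^ 2‖ < 1 := by
    rw [norm_mul, norm_pow, norm_pow, Complex.norm_real, Real.norm_eq_abs, sq_abs]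
    refine lt_of_le_of_lt ?_ (hcosh z hz)
    gcongr
    exact norm_sin_le_cosh_im z
  have hF := analyticAt_ordinaryHypergeometric_of_pos (a := 1 / 4) (b := 3 / 4) (c := 1 / 2)
    (by norm_num) (by norm_num) (by norm_num) hnorm
  push_cast at hF
  exact hF.differentiableAt.comp z (by fun_prop)

theorem dn2Integrand_ofReal (κ x : ℝ) : dn2Integrand κ x = dn2RealSpeed κ x := by
  rw [dn2Integrand, dn2RealSpeed, ofReal_ordinaryHypergeometric]
  push_cast
  rfl

theorem isHolomorphicSpeed_dn2Integrand (hκ : κ ^ 2 < 1) :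
    IsHolomorphicSpeed Real.pi (dn2Integrand κ) (dn2RealSpeed κ) where
  exists_differentiableOn := exists_differentiableOn_dn2Integrand hκ
  ofReal_eq := dn2Integrand_ofReal κ
  pos x := ordinaryHypergeometric_pos (by norm_num) (by norm_num) (by norm_num) (by positivity)
    (sq_mul_sin_sq_lt_one hκ x)
  period_pos := Real.pi_pos
  periodic x := by simp [dn2RealSpeed, Real.sin_add_pi]
  even x := by simp [dn2RealSpeed]

theorem analyticAt_dn2Integral (hκ : κ ^ 2 < 1) : AnalyticAt ℂ (dn2Integral κ) 0 := by
  simpa [dn2Integral_eq_segmentIntegral] using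
    (isHolomorphicSpeed_dn2Integrand hκ).analyticAt_segmentIntegral 0

theorem eventually_deriv_dn2Integral (hκ : κ ^ 2 < 1) :
    ∀ᶠ θ in 𝓝 0, deriv (dn2Integral κ) θ = dn2Integrand κ θ := by
  simpa [dn2Integral_eq_segmentIntegral] using
    ((isHolomorphicSpeed_dn2Integrand hκ).eventually_hasDerivAt_segmentIntegral 0).mono
      fun _ h => h.deriv

theorem deriv_dn2Integral_zero_ne_zero (hκ : κ ^ 2 < 1) : deriv (dn2Integral κ) 0 ≠ 0 := by
  rw [(eventually_deriv_dn2Integral hκ).self_of_nhds]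
  exact (isHolomorphicSpeed_dn2Integrand hκ).apply_zero_ne_zero

theorem map_dn2Integral_nhds_zero (hκ : κ ^ 2 < 1) : map (dn2Integral κ) (𝓝 0) = 𝓝 0 :=
  map_nhds_zero_of_deriv_ne_zero (analyticAt_dn2Integral hκ) (dn2Integral_zero κ)
    (deriv_dn2Integral_zero_ne_zero hκ)

theorem modularDelta_sq (κ : ℝ) (θ : ℂ) :
    modularDelta κ θ ^ 2 = 1 - (κ : ℂ) ^ 2 * Complex.sin θ ^ 2 :=
  Complex.cpow_ofNat_inv_pow _ 2

theorem modularDelta_zero (κ : ℝ) : modularDelta κ 0 = 1 := by simp [modularDelta]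

theorem modularDelta_ofReal (hκ : κ ^ 2 < 1) (x : ℝ) :
    modularDelta κ x = (√(1 - κ ^ 2 * Real.sin x ^ 2) : ℝ) := by
  rw [modularDelta, Real.sqrt_eq_rpow,
    Complex.ofReal_cpow (sub_pos.2 (sq_mul_sin_sq_lt_one hκ x)).le]
  norm_num

theorem analyticAt_modularDelta_ofReal (hκ : κ ^ 2 < 1) (x : ℝ) :
    AnalyticAt ℂ (modularDelta κ) x := by
  refine AnalyticAt.cpow (by fun_prop) analyticAt_const ?_
  have hpos : 0 < 1 - κ ^ 2 * Real.sin x ^ 2 := sub_pos.2 (sq_mul_sin_sq_lt_one hκ x)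
  exact_mod_cast Complex.ofReal_mem_slitPlane.2 hpos

theorem analyticAt_modularDelta_zero (hκ : κ ^ 2 < 1) : AnalyticAt ℂ (modularDelta κ) 0 := by
  simpa using analyticAt_modularDelta_ofReal hκ 0

theorem cos_eq_modularDelta {w θ : ℂ} (hsin : Complex.sin w = κ * Complex.sin θ)
    (hre : 0 < (Complex.cos w).re) : Complex.cos w = modularDelta κ θ := by
  rw [modularDelta, ← mul_pow, ← hsin, ← Complex.cos_sq', Complex.sq_cpow_two_inv hre]

theorem modularDelta_mul_deriv {θ : ℂ} (hΔ : DifferentiableAt ℂ (modularDelta κ) θ) :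
    modularDelta κ θ * deriv (modularDelta κ) θ =
      -(κ : ℂ) ^ 2 * (Complex.sin θ * Complex.cos θ) := by
  have hleft : HasDerivAt (fun z => modularDelta κ z ^ 2)
      (2 * modularDelta κ θ * deriv (modularDelta κ) θ) θ := by
    simpa using! hΔ.hasDerivAt.pow 2
  have hright : HasDerivAt (fun z => 1 - (κ : ℂ) ^ 2 * Complex.sin z ^ 2)
      (-(κ ^ 2 * (2 * Complex.sin θ * Complex.cos θ))) θ := by
    simpa using! (((Complex.hasDerivAt_sin θ).pow 2).const_mul ((κ : ℂ) ^ 2)).const_sub 1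
  simp only [modularDelta_sq] at hleft
  linear_combination (hleft.unique hright) / 2

theorem two_mul_sq_modularDelta_mul_dn2Integrand {θ : ℂ}
    (hθ : ‖(κ : ℂ) ^ 2 * Complex.sin θ ^ 2‖ < 1) :
    2 * (modularDelta κ θ * dn2Integrand κ θ) ^ 2 = 1 + modularDelta κ θ := by
  rw [mul_pow, modularDelta_sq, ← mul_assoc, dn2Integrand,
    two_mul_one_sub_mul_sq_ordinaryHypergeometric hθ, modularDelta]

theorem sq_deriv_modularDelta {θ : ℂ} (hΔ : DifferentiableAt ℂ (modularDelta κ) θ)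
    (hΔ₀ : modularDelta κ θ ≠ 0) (hθ : ‖(κ : ℂ) ^ 2 * Complex.sin θ ^ 2‖ < 1) :
    deriv (modularDelta κ) θ ^ 2 = dn2Integrand κ θ ^ 2 *
      (2 * (1 - modularDelta κ θ) * (κ ^ 2 - 1 + modularDelta κ θ ^ 2)) := by
  refine mul_left_cancel₀ (pow_ne_zero 2 hΔ₀) ?_
  rw [← mul_pow, modularDelta_mul_deriv hΔ]
  linear_combination (κ : ℂ) ^ 4 * Complex.sin θ ^ 2 * Complex.sin_sq_add_cos_sq θ -
    (1 - modularDelta κ θ) * (κ ^ 2 - 1 + modularDelta κ θ ^ 2) *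
      two_mul_sq_modularDelta_mul_dn2Integrand hθ +
    (κ ^ 2 - 1 + modularDelta κ θ ^ 2 - κ ^ 2 * Complex.sin θ ^ 2) * modularDelta_sq κ θ

theorem isCubicGerm_one_sub_modularDelta (hκ₀ : κ ≠ 0) (hκ₁ : κ ^ 2 < 1) :
    IsCubicGerm (2 * κ ^ 2) (-4) 2 (dn2Integral κ) fun θ => 1 - modularDelta κ θ := by
  have hΔ := analyticAt_modularDelta_zero hκ₁
  refine ⟨analyticAt_dn2Integral hκ₁, dn2Integral_zero κ, deriv_dn2Integral_zero_ne_zero hκ₁,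
    analyticAt_const.sub hΔ, by simp [modularDelta_zero], ?_, fun hzero => ?_⟩
  · have hnorm : ∀ᶠ θ in 𝓝 0, ‖(κ : ℂ) ^ 2 * Complex.sin θ ^ 2‖ < 1 :=
      ContinuousAt.eventually_lt (by fun_prop) continuousAt_const (by simp)
    filter_upwards [hΔ.eventually_analyticAt, hΔ.continuousAt.eventually_ne
      (y := 0) (by simp [modularDelta_zero]), hnorm, eventually_deriv_dn2Integral hκ₁]
      with θ hΔθ hΔ₀ hθ hderiv
    rw [deriv_const_sub, neg_sq, sq_deriv_modularDelta hΔθ.differentiableAt hΔ₀ hθ, hderiv]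
    ring
  · refine not_eventually_sin_eq_zero (hzero.mono fun θ hθ => ?_)
    have hsq := modularDelta_sq κ θ
    rw [← sub_eq_zero.1 hθ, one_pow, eq_comm, sub_eq_self] at hsq
    simpa [hκ₀] using hsq

end Germ

/-! ### Existence and uniqueness of `dn₂` -/

section Existence

variable {κ : ℝ} {d d₁ d₂ : ℂ → ℂ}

theorem eventually_re_cos_pos {ψ : ℂ → ℂ} {x : ℂ} (hψ : ContinuousAt ψ x) (hψx : ψ x = 0) :
    ∀ᶠ z in 𝓝 x, 0 < (Complex.cos (ψ z)).re :=
  continuousAt_const.eventually_lt (g := fun z => (Complex.cos (ψ z)).re) (by fun_prop)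
    (by simp [hψx])

namespace IsDn2

theorem apply_dn2Integral (hκ : κ ^ 2 < 1) (hd : IsDn2 κ d) :
    ∀ᶠ θ in 𝓝 0, d (dn2Integral κ θ) = modularDelta κ θ := by
  obtain ⟨φ, ψ, hφ, hφ₀, hfφ, hψ, hψ₀, hsin, hcos⟩ := hd.germ
  obtain ⟨χ, -, -, -, hχf⟩ := exists_analyticAt_local_inverse (analyticAt_dn2Integral hκ)
    (dn2Integral_zero κ) (deriv_dn2Integral_zero_ne_zero hκ)
  have htendsto_φ : Tendsto φ (𝓝 0) (𝓝 0) := by simpa only [hφ₀] using hφ.continuousAt.tendsto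
  have hφχ : ∀ᶠ z in 𝓝 0, φ z = χ z := by
    filter_upwards [hfφ, htendsto_φ.eventually hχf] with z hfφz hχfz
    rw [← hχfz, hfφz]
  have hre := eventually_re_cos_pos hψ.continuousAt hψ₀
  have htendsto : Tendsto (dn2Integral κ) (𝓝 0) (𝓝 0) := (map_dn2Integral_nhds_zero hκ).le
  filter_upwards [hχf, htendsto.eventually hφχ, htendsto.eventually hsin, htendsto.eventually hre,
    htendsto.eventually hcos] with θ hχfθ hφχθ hsinθ hreθ hcosθ
  rw [hφχθ, hχfθ] at hsinθ
  rw [hcosθ, cos_eq_modularDelta hsinθ hreθ]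

theorem isCubicGerm_one_sub (hκ₀ : κ ≠ 0) (hκ₁ : κ ^ 2 < 1) (hd : IsDn2 κ d) :
    IsCubicGerm (2 * κ ^ 2) (-4) 2 id fun z => 1 - d z :=
  (isCubicGerm_one_sub_modularDelta hκ₀ hκ₁).of_comp <|
    (hd.apply_dn2Integral hκ₁).mono fun _ hθ => congrArg (1 - ·) hθ

protected theorem unique (hκ : κ ^ 2 < 1) (hd₁ : IsDn2 κ d₁) (hd₂ : IsDn2 κ d₂) : d₁ = d₂ := by
  have hgerm : d₁ =ᶠ[𝓝 0] d₂ := by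
    rw [← map_dn2Integral_nhds_zero hκ, EventuallyEq, eventually_map]
    filter_upwards [hd₁.apply_dn2Integral hκ, hd₂.apply_dn2Integral hκ] with θ h₁ h₂
    rw [h₁, h₂]
  exact funext fun z => meromorphicNFOn_eqOn_of_eventuallyEq hd₁.meromorphic hd₂.meromorphic
    isPreconnected_univ (mem_univ 0) hgerm (mem_univ z)

end IsDn2

theorem isDn2_of_apply_dn2Integral (hκ : κ ^ 2 < 1) (hd : MeromorphicNFOn d univ)
    (hgerm : ∀ᶠ θ in 𝓝 0, d (dn2Integral κ θ) = modularDelta κ θ) : IsDn2 κ d := by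
  obtain ⟨φ, hφ, hφ₀, hfφ, -⟩ := exists_analyticAt_local_inverse (analyticAt_dn2Integral hκ)
    (dn2Integral_zero κ) (deriv_dn2Integral_zero_ne_zero hκ)
  obtain ⟨arcsin, harcsin, harcsin₀, hsin_arcsin, -⟩ :=
    exists_analyticAt_local_inverse Complex.analyticAt_sin Complex.sin_zero (by simp)
  have hκsin : AnalyticAt ℂ (fun z => (κ : ℂ) * Complex.sin (φ z)) 0 := by fun_prop
  have hκsin₀ : (κ : ℂ) * Complex.sin (φ 0) = 0 := by simp [hφ₀]
  have htendsto_φ : Tendsto φ (𝓝 0) (𝓝 0) := by simpa only [hφ₀] using hφ.continuousAt.tendsto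
  have hψ : AnalyticAt ℂ (fun z => arcsin (κ * Complex.sin (φ z))) 0 :=
    AnalyticAt.fun_comp (by rwa [hκsin₀]) hκsin
  have hψ₀ : arcsin (κ * Complex.sin (φ 0)) = 0 := by rw [hκsin₀, harcsin₀]
  have hsin : ∀ᶠ z in 𝓝 0,
      Complex.sin (arcsin (κ * Complex.sin (φ z))) = κ * Complex.sin (φ z) :=
    Tendsto.eventually (by simpa only [hκsin₀] using hκsin.continuousAt.tendsto) hsin_arcsin
  have hre := eventually_re_cos_pos hψ.continuousAt hψ₀
  refine ⟨hd, φ, _, hφ, hφ₀, hfφ, hψ, hψ₀, hsin, ?_⟩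
  filter_upwards [hfφ, hsin, hre, htendsto_φ.eventually hgerm] with z hfφz hsinz hrez hgermz
  rw [cos_eq_modularDelta hsinz hrez, ← hgermz, hfφz]

theorem exists_isDn2 (hκ₀ : κ ≠ 0) (hκ₁ : κ ^ 2 < 1) : ∃ d : ℂ → ℂ, IsDn2 κ d := by
  obtain ⟨χ, hχ, hχ₀, -, hχf⟩ := exists_analyticAt_local_inverse (analyticAt_dn2Integral hκ₁)
    (dn2Integral_zero κ) (deriv_dn2Integral_zero_ne_zero hκ₁)
  have hΔχ : AnalyticAt ℂ (modularDelta κ ∘ χ) 0 :=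
    AnalyticAt.comp (by simpa only [hχ₀] using analyticAt_modularDelta_zero hκ₁) hχ
  have hcubic : IsCubicGerm (2 * κ ^ 2) (-4) 2 id fun z => 1 - modularDelta κ (χ z) :=
    (isCubicGerm_one_sub_modularDelta hκ₀ hκ₁).of_comp <|
      hχf.mono fun θ hθ => congrArg (1 - modularDelta κ ·) hθ
  obtain ⟨d, hd, hdΔ⟩ := exists_meromorphicNFOn_univ_of_multiplication
    (R := fun x => 1 - cubicDoubling (2 * κ ^ 2) (-4) 2 (1 - x)) (q := 2) hΔχ
    (fun f x hf => by unfold cubicDoubling; fun_prop) (by simp)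
    ((hcubic.doubling (by simpa using hκ₀)).mono fun z hz => by simp [← hz])
  refine ⟨d, isDn2_of_apply_dn2Integral hκ₁ hd ?_⟩
  filter_upwards [hχf, (map_dn2Integral_nhds_zero hκ₁).le hdΔ] with θ hθ hdθ
  rw [hdθ, Function.comp_apply, hθ]

end Existence

/-! ### `dn₂` on the real and imaginary axes -/

/-- The speed `√2 / √(1 - (1 - κ²) cos⁴ t)` on the imaginary axis: its primitive `y` is the
parameter for which `dn₂ (i y) = 1 / cos² θ`, found by substituting this into the differential
equation of `dn₂`. -/
noncomputable def dn2ImagSpeed (κ t : ℝ) : ℝ := √2 / √(1 - (1 - κ ^ 2) * Real.cos t ^ 4)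

/-- The holomorphic extension of `dn2ImagSpeed`, with the principal square root. -/
noncomputable def dn2ImagIntegrand (κ : ℝ) (t : ℂ) : ℂ :=
  (√2 : ℝ) / (1 - (1 - (κ : ℂ) ^ 2) * Complex.cos t ^ 4) ^ (2⁻¹ : ℂ)

section Axes

variable {κ : ℝ} {d : ℂ → ℂ}

theorem one_sub_mul_cos_pow_four_pos (hκ₀ : κ ≠ 0) (hκ₁ : κ ^ 2 < 1) (x : ℝ) :
    0 < 1 - (1 - κ ^ 2) * Real.cos x ^ 4 := by
  have hcos : Real.cos x ^ 4 ≤ 1 := by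
    rw [← Even.pow_abs (by decide)]
    exact pow_le_one₀ (abs_nonneg _) (Real.abs_cos_le_one x)
  have hmul : (1 - κ ^ 2) * Real.cos x ^ 4 ≤ 1 - κ ^ 2 :=
    mul_le_of_le_one_right (sub_pos.2 hκ₁).le hcos
  linarith [sq_pos_of_ne_zero hκ₀]

theorem exists_realStrip_mem_slitPlane (hκ₀ : κ ≠ 0) (hκ₁ : κ ^ 2 < 1) :
    ∃ δ > 0, ∀ z ∈ realStrip δ,
      1 - (1 - (κ : ℂ) ^ 2) * Complex.cos z ^ 4 ∈ Complex.slitPlane := by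
  obtain ⟨δ, hδ, hcosh⟩ := exists_realStrip_mul_cosh_pow_lt_one
    (sub_lt_self 1 (sq_pos_of_ne_zero hκ₀)) 4
  refine ⟨δ, hδ, fun z hz => ?_⟩
  rw [sub_eq_add_neg]
  refine Complex.mem_slitPlane_of_norm_lt_one (lt_of_le_of_lt ?_ (hcosh z hz))
  have hnorm : ‖1 - (κ : ℂ) ^ 2‖ = 1 - κ ^ 2 := by
    rw [← Complex.norm_of_nonneg (sub_pos.2 hκ₁).le]
    push_cast
    rfl
  rw [norm_neg, norm_mul, norm_pow, hnorm]
  have := norm_cos_le_cosh_im z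
  have := sub_pos.2 hκ₁
  gcongr

theorem isHolomorphicSpeed_dn2ImagIntegrand (hκ₀ : κ ≠ 0) (hκ₁ : κ ^ 2 < 1) :
    IsHolomorphicSpeed Real.pi (dn2ImagIntegrand κ) (dn2ImagSpeed κ) where
  exists_differentiableOn := by
    obtain ⟨δ, hδ, hslit⟩ := exists_realStrip_mem_slitPlane hκ₀ hκ₁
    refine ⟨δ, hδ, fun z hz => DifferentiableAt.differentiableWithinAt ?_⟩
    refine (differentiableAt_const _).div
      (DifferentiableAt.cpow (by fun_prop) (by fun_prop) (hslit z hz)) ?_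
    simp [Complex.cpow_eq_zero_iff, Complex.slitPlane_ne_zero (hslit z hz)]
  ofReal_eq x := by
    rw [dn2ImagIntegrand, dn2ImagSpeed, Complex.ofReal_div, Real.sqrt_eq_rpow (1 - _),
      Complex.ofReal_cpow (one_sub_mul_cos_pow_four_pos hκ₀ hκ₁ x).le]
    norm_num
  pos x := div_pos (by positivity) (Real.sqrt_pos.2 (one_sub_mul_cos_pow_four_pos hκ₀ hκ₁ x))
  period_pos := Real.pi_pos
  periodic x := by simp [dn2ImagSpeed, Real.cos_add_pi, Even.neg_pow (show Even 4 by decide)]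
  even x := by simp [dn2ImagSpeed]

theorem sq_dn2ImagIntegrand_mul {z : ℂ} (hz : 1 - (1 - (κ : ℂ) ^ 2) * Complex.cos z ^ 4 ≠ 0) :
    dn2ImagIntegrand κ z ^ 2 * (1 - (1 - (κ : ℂ) ^ 2) * Complex.cos z ^ 4) = 2 := by
  have hsqrt : ((√2 : ℝ) : ℂ) ^ 2 = 2 := mod_cast Real.sq_sqrt zero_le_two
  have hcpow : ((1 - (1 - (κ : ℂ) ^ 2) * Complex.cos z ^ 4) ^ (2⁻¹ : ℂ)) ^ 2 =
      1 - (1 - (κ : ℂ) ^ 2) * Complex.cos z ^ 4 := Complex.cpow_ofNat_inv_pow _ 2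
  rw [dn2ImagIntegrand, div_pow, hsqrt, hcpow, div_mul_cancel₀ _ hz]

theorem hasDerivAt_inv_cos_sq {θ : ℂ} (hθ : Complex.cos θ ≠ 0) :
    HasDerivAt (fun z => (Complex.cos z ^ 2)⁻¹) (2 * Complex.sin θ / Complex.cos θ ^ 3) θ := by
  refine (((Complex.hasDerivAt_cos θ).fun_pow 2).fun_inv (pow_ne_zero 2 hθ)).congr_deriv ?_
  norm_num
  field_simp

theorem isCubicGerm_one_sub_inv_cos_sq (hκ₀ : κ ≠ 0) (hκ₁ : κ ^ 2 < 1) :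
    IsCubicGerm (2 * κ ^ 2) (-4) 2 (fun θ => Complex.I * segmentIntegral (dn2ImagIntegrand κ) θ)
      fun θ => 1 - (Complex.cos θ ^ 2)⁻¹ := by
  have hspeed := isHolomorphicSpeed_dn2ImagIntegrand hκ₀ hκ₁
  have hanalytic := hspeed.analyticAt_segmentIntegral 0
  have hderiv := hspeed.eventually_hasDerivAt_segmentIntegral 0
  rw [Complex.ofReal_zero] at hanalytic hderiv
  refine ⟨analyticAt_const.mul hanalytic, by simp [segmentIntegral_zero], ?_,
    analyticAt_const.sub (AnalyticAt.inv (by fun_prop) (by simp)), by simp, ?_, fun hzero => ?_⟩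
  · rw [(hderiv.self_of_nhds.const_mul Complex.I).deriv]
    exact mul_ne_zero Complex.I_ne_zero hspeed.apply_zero_ne_zero
  · have hcos : ∀ᶠ θ in 𝓝 0, Complex.cos θ ≠ 0 := ContinuousAt.eventually_ne (by fun_prop) (by simp)
    have hquartic : ∀ᶠ θ in 𝓝 0, 1 - (1 - (κ : ℂ) ^ 2) * Complex.cos θ ^ 4 ≠ 0 :=
      ContinuousAt.eventually_ne (by fun_prop) (by simpa using hκ₀)
    filter_upwards [hderiv, hcos, hquartic] with θ hderivθ hcosθ hquarticθ
    rw [(hderivθ.const_mul Complex.I).deriv, ((hasDerivAt_inv_cos_sq hcosθ).const_sub 1).deriv,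
      mul_pow, Complex.I_sq]
    have hspeedθ := sq_dn2ImagIntegrand_mul hquarticθ
    field_simp
    linear_combination (4 : ℂ) * Complex.sin_sq_add_cos_sq θ - 2 * (1 - Complex.cos θ ^ 2) * hspeedθ
  · refine not_eventually_sin_eq_zero (hzero.mono fun θ hθ => ?_)
    have hcos : Complex.cos θ ^ 2 = 1 := inv_eq_one.1 (sub_eq_zero.1 hθ).symm
    simpa [hcos] using Complex.sin_sq θ

namespace IsDn2

theorem apply_integral_dn2RealSpeed (hκ : κ ^ 2 < 1) (hd : IsDn2 κ d) (x : ℝ) :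
    d ((∫ t in (0 : ℝ)..x, dn2RealSpeed κ t : ℝ) : ℂ) =
      (√(1 - κ ^ 2 * Real.sin x ^ 2) : ℝ) := by
  simpa only [one_mul, modularDelta_ofReal hκ] using
    (isHolomorphicSpeed_dn2Integrand hκ).apply_mul_integral_of_germ (c := 1) hd.meromorphic
      (fun y => (analyticAt_modularDelta_ofReal hκ y).meromorphicNFAt)
      (by simpa only [one_mul] using dn2Integral_eq_segmentIntegral κ ▸ hd.apply_dn2Integral hκ) x

theorem apply_I_mul_integral_dn2ImagSpeed (hκ₀ : κ ≠ 0) (hκ₁ : κ ^ 2 < 1) (hd : IsDn2 κ d)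
    (x : ℝ) : d (Complex.I * ((∫ t in (0 : ℝ)..x, dn2ImagSpeed κ t : ℝ) : ℂ)) =
      (Complex.cos x ^ 2)⁻¹ := by
  refine (isHolomorphicSpeed_dn2ImagIntegrand hκ₀ hκ₁).apply_mul_integral_of_germ hd.meromorphic
    (h := fun θ => (Complex.cos θ ^ 2)⁻¹) (fun y => ?_) ?_ x
  · have hcos : AnalyticAt ℂ (fun θ => Complex.cos θ ^ 2) (y : ℂ) := by fun_prop
    exact hcos.meromorphicNFAt.inv
  · filter_upwards [(hd.isCubicGerm_one_sub hκ₀ hκ₁).comp_eventuallyEq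
      (isCubicGerm_one_sub_inv_cos_sq hκ₀ hκ₁)] with θ hθ using sub_right_injective hθ

end IsDn2

end Axes

/-! ### The period lattice -/

section Lattice

variable {d : ℂ → ℂ} {K K' L L' : ℝ} {w : ℂ}

theorem periodic_conj_of_conj_apply_conj (hconj : ∀ z, conj (d (conj z)) = d z)
    (hw : Function.Periodic d w) : Function.Periodic d (conj w) := fun z => by
  rw [← hconj (z + conj w), map_add, Complex.conj_conj, hw, hconj]

theorem exists_int_eq_of_periodic (hconj : ∀ z, conj (d (conj z)) = d z)
    (hreal : ∀ y : ℝ, d y = d 0 → ∃ m : ℤ, y = m * (2 * K))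
    (himag : ∀ y : ℝ, d (Complex.I * y) = d 0 → ∃ n : ℤ, y = n * (2 * K'))
    (hw : Function.Periodic d w) :
    ∃ m n : ℤ, w = m * (K : ℂ) + n * ((K' : ℂ) * Complex.I) := by
  have hw_conj := periodic_conj_of_conj_apply_conj hconj hw
  have hre : d ((2 * w.re : ℝ) : ℂ) = d 0 := by
    rw [← Complex.add_conj, ← zero_add (w + _), hw.add_period hw_conj 0]
  have him : d (Complex.I * ((2 * w.im : ℝ) : ℂ)) = d 0 := by
    rw [mul_comm, ← Complex.sub_conj, ← zero_add (w - _), hw.sub_period hw_conj 0]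
  obtain ⟨m, hm⟩ := hreal _ hre
  obtain ⟨n, hn⟩ := himag _ him
  refine ⟨m, n, ?_⟩
  rw [← Complex.re_add_im w, show w.re = m * K by linarith, show w.im = n * K' by linarith]
  push_cast
  ring

theorem isFundamentalHalfPeriods_of_conj_apply_conj (hK : 0 < K) (hK' : 0 < K')
    (hper : Function.Periodic d (2 * K)) (hper' : Function.Periodic d (2 * K' * Complex.I))
    (hconj : ∀ z, conj (d (conj z)) = d z)
    (hreal : ∀ y : ℝ, d y = d 0 → ∃ m : ℤ, y = m * (2 * K))
    (himag : ∀ y : ℝ, d (Complex.I * y) = d 0 → ∃ n : ℤ, y = n * (2 * K'))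
    (hne : d K ≠ d (Complex.I * K')) : IsFundamentalHalfPeriods d K K' := by
  refine ⟨hK, hK', fun w => ⟨fun hw => ?_, ?_⟩⟩
  · obtain ⟨m, n, rfl⟩ := exists_int_eq_of_periodic hconj hreal himag hw
    rcases m.even_or_odd' with ⟨a, rfl | rfl⟩
    · obtain ⟨b, hb⟩ := himag (n * K') <| by
        rw [← hw.sub_period (hper.int_mul a) 0]
        push_cast
        ring_nf
      refine ⟨a, b, ?_⟩
      rw [← mul_assoc, ← mul_assoc, show (n : ℂ) * K' = b * (2 * K') by exact_mod_cast hb]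
      push_cast
      ring
    rcases n.even_or_odd' with ⟨b, rfl | rfl⟩
    · obtain ⟨c, hc⟩ := hreal ((2 * a + 1 : ℤ) * K) <| by
        rw [← hw.sub_period (hper'.int_mul b) 0]
        push_cast
        ring_nf
      refine ⟨c, b, ?_⟩
      rw [show ((2 * a + 1 : ℤ) : ℂ) * K = c * (2 * K) by exact_mod_cast hc]
      push_cast
      ring
    · refine absurd ?_ hne
      rw [← (hw.sub_period ((hper.int_mul a).add_period (hper'.int_mul (b + 1)))) (Complex.I * K')]
      push_cast
      ring_nf
  · rintro ⟨m, n, rfl⟩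
    exact (hper.int_mul m).add_period (hper'.int_mul n)

namespace IsFundamentalHalfPeriods

theorem real_le (hK : IsFundamentalHalfPeriods d K K') (hL : IsFundamentalHalfPeriods d L L') :
    K ≤ L := by
  obtain ⟨m, n, hmn⟩ := (hK.periodic_iff (2 * L)).1 ((hL.periodic_iff _).2 ⟨1, 0, by simp⟩)
  have hre : 2 * L = m * (2 * K) := by simpa using congrArg Complex.re hmn
  have hL_eq : L = m * K := by linarith
  have hm : (0 : ℝ) < m := pos_of_mul_pos_left (hL_eq ▸ hL.pos) hK.pos.le
  rw [hL_eq]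
  exact le_mul_of_one_le_left hK.pos.le (mod_cast hm)

theorem real_unique (hK : IsFundamentalHalfPeriods d K K')
    (hL : IsFundamentalHalfPeriods d L L') : K = L :=
  le_antisymm (hK.real_le hL) (hL.real_le hK)

end IsFundamentalHalfPeriods

end Lattice

namespace IsDn2

variable {κ : ℝ} {d : ℂ → ℂ}

theorem apply_zero (hκ : κ ^ 2 < 1) (hd : IsDn2 κ d) : d 0 = 1 := by
  simpa using hd.apply_integral_dn2RealSpeed hκ 0

theorem conj_apply_conj (hκ : κ ^ 2 < 1) (hd : IsDn2 κ d) (z : ℂ) :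
    conj (d (conj z)) = d z := by
  refine conj_apply_conj_of_real_on_line hd.meromorphic (fun y => ?_) z
  obtain ⟨x, rfl⟩ := (isHolomorphicSpeed_dn2Integrand hκ).surjective_integral y
  rw [hd.apply_integral_dn2RealSpeed hκ, Complex.conj_ofReal]

theorem periodic_integral_dn2RealSpeed (hκ : κ ^ 2 < 1) (hd : IsDn2 κ d) :
    Function.Periodic d ((∫ t in (0 : ℝ)..Real.pi, dn2RealSpeed κ t : ℝ) : ℂ) := by
  simpa only [one_mul] using
    (isHolomorphicSpeed_dn2Integrand hκ).periodic_of_apply_mul_integral hd.meromorphic one_ne_zero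
      (h := fun x => ((√(1 - κ ^ 2 * Real.sin x ^ 2) : ℝ) : ℂ))
      (fun x => by simp [Real.sin_add_pi])
      (fun x => by rw [one_mul, hd.apply_integral_dn2RealSpeed hκ])

theorem periodic_I_mul_integral_dn2ImagSpeed (hκ₀ : κ ≠ 0) (hκ₁ : κ ^ 2 < 1) (hd : IsDn2 κ d) :
    Function.Periodic d (Complex.I * ((∫ t in (0 : ℝ)..Real.pi, dn2ImagSpeed κ t : ℝ) : ℂ)) :=
  (isHolomorphicSpeed_dn2ImagIntegrand hκ₀ hκ₁).periodic_of_apply_mul_integral hd.meromorphic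
    Complex.I_ne_zero (h := fun x : ℝ => (Complex.cos x ^ 2)⁻¹)
    (fun x => by simp [Complex.cos_add_pi]) (hd.apply_I_mul_integral_dn2ImagSpeed hκ₀ hκ₁)

theorem exists_int_of_apply_ofReal_eq_one (hκ₀ : κ ≠ 0) (hκ₁ : κ ^ 2 < 1) (hd : IsDn2 κ d) {y : ℝ}
    (hy : d y = 1) : ∃ m : ℤ, y = m * ∫ t in (0 : ℝ)..Real.pi, dn2RealSpeed κ t := by
  have hspeed := isHolomorphicSpeed_dn2Integrand hκ₁
  obtain ⟨x, rfl⟩ := hspeed.surjective_integral y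
  rw [hd.apply_integral_dn2RealSpeed hκ₁, Complex.ofReal_eq_one, Real.sqrt_eq_one,
    sub_eq_self] at hy
  obtain ⟨m, rfl⟩ := Real.sin_eq_zero_iff.1 (by simpa [hκ₀] using hy)
  exact ⟨m, hspeed.integral_int_mul_period m⟩

theorem exists_int_of_apply_I_mul_eq_one (hκ₀ : κ ≠ 0) (hκ₁ : κ ^ 2 < 1) (hd : IsDn2 κ d) {y : ℝ}
    (hy : d (Complex.I * y) = 1) :
    ∃ n : ℤ, y = n * ∫ t in (0 : ℝ)..Real.pi, dn2ImagSpeed κ t := by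
  have hspeed := isHolomorphicSpeed_dn2ImagIntegrand hκ₀ hκ₁
  obtain ⟨x, rfl⟩ := hspeed.surjective_integral y
  rw [hd.apply_I_mul_integral_dn2ImagSpeed hκ₀ hκ₁, inv_eq_one] at hy
  have hcos : Real.cos x ^ 2 = 1 := mod_cast hy
  obtain ⟨n, rfl⟩ := Real.sin_eq_zero_iff.1 (by simpa [hcos] using Real.sin_sq x)
  exact ⟨n, hspeed.integral_int_mul_period n⟩

theorem isFundamentalHalfPeriods (hκ₀ : κ ≠ 0) (hκ₁ : κ ^ 2 < 1) (hd : IsDn2 κ d) :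
    IsFundamentalHalfPeriods d ((∫ t in (0 : ℝ)..Real.pi, dn2RealSpeed κ t) / 2)
      ((∫ t in (0 : ℝ)..Real.pi, dn2ImagSpeed κ t) / 2) := by
  have hreal := isHolomorphicSpeed_dn2Integrand hκ₁
  have himag := isHolomorphicSpeed_dn2ImagIntegrand hκ₀ hκ₁
  have hne : d ((∫ t in (0 : ℝ)..Real.pi / 2, dn2RealSpeed κ t : ℝ) : ℂ) ≠
      d (Complex.I * ((∫ t in (0 : ℝ)..Real.pi / 2, dn2ImagSpeed κ t : ℝ) : ℂ)) := by
    rw [hd.apply_integral_dn2RealSpeed hκ₁, hd.apply_I_mul_integral_dn2ImagSpeed hκ₀ hκ₁,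
      ← Complex.ofReal_cos, Real.cos_pi_div_two]
    simpa using (Real.sqrt_pos.2 (sub_pos.2 hκ₁)).ne'
  rw [hreal.integral_half_period, himag.integral_half_period] at hne
  refine isFundamentalHalfPeriods_of_conj_apply_conj (half_pos hreal.integral_period_pos)
    (half_pos himag.integral_period_pos) ?_ ?_ (hd.conj_apply_conj hκ₁) (fun y hy => ?_)
    (fun y hy => ?_) hne
  · simpa [mul_div_cancel₀] using hd.periodic_integral_dn2RealSpeed hκ₁
  · simpa [mul_div_cancel₀, mul_comm] using hd.periodic_I_mul_integral_dn2ImagSpeed hκ₀ hκ₁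
  · rw [mul_div_cancel₀ _ two_ne_zero]
    exact hd.exists_int_of_apply_ofReal_eq_one hκ₀ hκ₁ (hy.trans (hd.apply_zero hκ₁))
  · rw [mul_div_cancel₀ _ two_ne_zero]
    exact hd.exists_int_of_apply_I_mul_eq_one hκ₀ hκ₁ (hy.trans (hd.apply_zero hκ₁))

end IsDn2

theorem integral_dn2RealSpeed {κ : ℝ} (hκ : κ ^ 2 < 1) :
    ∫ t in (0 : ℝ)..Real.pi, dn2RealSpeed κ t =
      Real.pi * ₂F₁ (1 / 4 : ℝ) (3 / 4 : ℝ) (1 : ℝ) (κ ^ 2) :=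
  integral_ordinaryHypergeometric_mul_sin_sq
    (fun k => ⟨natCast_ne_neg_of_pos (by norm_num) k, natCast_ne_neg_of_pos (by norm_num) k⟩)
    (by rwa [abs_of_nonneg (sq_nonneg κ)])

theorem mainTheorem2 (κ : ℝ) (hκ₀ : 0 < κ) (hκ₁ : κ < 1) :
    (∃! d : ℂ → ℂ, IsDn2 κ d) ∧
    ∀ d : ℂ → ℂ, IsDn2 κ d →
      (∃ K K' : ℝ, IsFundamentalHalfPeriods d K K') ∧
      ∀ K K' : ℝ, IsFundamentalHalfPeriods d K K' →
        K = Real.pi / 2 * ₂F₁ (1 / 4 : ℝ) (3 / 4 : ℝ) (1 : ℝ) (κ ^ 2) := by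
  have hκ_sq : κ ^ 2 < 1 := pow_lt_one₀ hκ₀.le hκ₁ two_ne_zero
  obtain ⟨d₀, hd₀⟩ := exists_isDn2 hκ₀.ne' hκ_sq
  refine ⟨⟨d₀, hd₀, fun d hd => hd.unique hκ_sq hd₀⟩, fun d hd => ?_⟩
  have hperiods := hd.isFundamentalHalfPeriods hκ₀.ne' hκ_sq
  refine ⟨⟨_, _, hperiods⟩, fun K K' hK => ?_⟩
  rw [hK.real_unique hperiods, integral_dn2RealSpeed hκ_sq, mul_div_right_comm]
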